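/- Let $G$ be a finite simple connected graph with vertex set $V$ and edge set $E(G)$, and let $K$ be a field. A cut is an unordered partition $A|B$ of $V$ into two disjoint (possibly empty) sets with $A\cup B=V$. In the polynomial ring $K[s,t_e \mid e\in E(G)]$ put $$u_{A|B}=s\cdot\prod_{\substack{ij\in E(G)\\ |A\cap\{i,j\}|=1}} t_{ij},$$ and let $R_G=K[u_{A|B} \mid A|B \text{ a cut}]$ be the $K$-subalgebra generated by these monomials (the toric ring of the cut ideal of $G$, the cut ideal being the kernel of the homomorphism $K[q_{A|B}]\to K[s,t_e\mid e\in E(G)]$, $q_{A|B}\mapsto u_{A|B}$), graded by $\deg u_{A|B}=1$. The ring $R_G$ is called strongly Koszul if for any two distinct cuts $A|B\neq C|D$ the ideal $(u_{A|B})\cap(u_{C|D})$ of $R_G$ is generated by elements of degree $2$. Then $R_G$ is strongly Koszul if and only if $G$ has neither the complete graph $K_4$ nor the cycle $C_5$ of length $5$ as a minor. -/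

import Mathlib

section Minor

/-- `H` is a minor of `G`: there are pairwise disjoint branch sets `B w`, one for each vertex `w`
of `H`, each inducing a connected (in particular nonempty) subgraph of `G`, such that for every
edge `ww'` of `H` some edge of `G` joins `B w` to `B w'`. Contracting the branch sets and deleting
what is superfluous turns `G` into `H`. -/
def SimpleGraph.HasMinor {V W : Type*} (G : SimpleGraph V) (H : SimpleGraph W) : Prop :=
  ∃ B : W → Set V,
    (∀ w, (G.induce (B w)).Connected) ∧
    (∀ w w', w ≠ w' → Disjoint (B w) (B w')) ∧
    (∀ w w', H.Adj w w' → ∃ x ∈ B w, ∃ y ∈ B w', G.Adj x y)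

end Minor

namespace CutIdeal

/-- An unordered partition `A|B` of the vertex set, where `B` is the complement of `A`
(one of the two parts may be empty). -/
def Cut (V : Type*) : Type _ :=
  {p : Sym2 (Set V) // ∃ A : Set V, p = s(A, Aᶜ)}

/-- The cut `A|B` separates the edge `ij`, that is, exactly one of `i`, `j` lies in `A`. -/
def Cut.Separates {V : Type*} (c : Cut V) (e : Sym2 V) : Prop :=
  ∃ A ∈ c.1, ∃ i j : V, e = s(i, j) ∧ i ∈ A ∧ j ∉ A

/-- The polynomial ring `K[s, t_e | e ∈ E(G)]`: the variable `none` is `s`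
and `some e` is `t_e`. -/
abbrev EdgeRing (K : Type*) [Field K] {V : Type*} (G : SimpleGraph V) : Type _ :=
  MvPolynomial (Option G.edgeSet) K

open Classical in
/-- The monomial `s * ∏ t_e`, the product running over the edges separated by the cut. -/
noncomputable def cutMonomial (K : Type*) [Field K] {V : Type*} [Fintype V]
    (G : SimpleGraph V) (c : Cut V) : EdgeRing K G :=
  (MvPolynomial.X none : EdgeRing K G) *
    ∏ e ∈ Finset.univ.filter (fun e : G.edgeSet => c.Separates (e : Sym2 V)),
      (MvPolynomial.X (some e) : EdgeRing K G)

/-- The homomorphism `K[q_c | c a cut] → K[s, t_e | e ∈ E(G)]` sending `q_c` to the monomial of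
`c`. Its kernel is the cut ideal of `G`. -/
noncomputable def cutHom (K : Type*) [Field K] {V : Type*} [Fintype V] (G : SimpleGraph V) :
    MvPolynomial (Cut V) K →ₐ[K] EdgeRing K G :=
  MvPolynomial.aeval (cutMonomial K G)

/-- The toric ring `R_G` of the cut ideal of `G`, the image of `cutHom`. -/
noncomputable abbrev toricRing (K : Type*) [Field K] {V : Type*} [Fintype V]
    (G : SimpleGraph V) : Subalgebra K (EdgeRing K G) :=
  (cutHom K G).range

/-- The generator `u_{A|B}` of the toric ring. -/
noncomputable def gen (K : Type*) [Field K] {V : Type*} [Fintype V] (G : SimpleGraph V)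
    (c : Cut V) : toricRing K G :=
  (cutHom K G).rangeRestrict (MvPolynomial.X c)

/-- Let `R` be generated as a `K`-algebra by the family `u`, each `u i` having degree `1`, so that
the component of degree `d` of `R` is the `K`-span of the products of `d` generators.
The ideal `I` is generated in degree `d` if it is generated by a set of elements of degree `d`. -/
def GeneratedInDegree (K : Type*) [Field K] {R ι : Type*} [CommRing R] [Algebra K R]
    (u : ι → R) (d : ℕ) (I : Ideal R) : Prop :=
  ∃ S : Set R, S ⊆ ((Submodule.span K (Set.range u) ^ d : Submodule K R) : Set R) ∧
    I = Ideal.span S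

/-- Strong Koszulness of a semigroup ring with generators `u i` of degree `1`: for all `i ≠ j` the
ideal `(u i) ∩ (u j)` is generated in degree `2`. -/
def StronglyKoszul (K : Type*) [Field K] {R ι : Type*} [CommRing R] [Algebra K R]
    (u : ι → R) : Prop :=
  ∀ i j : ι, i ≠ j →
    GeneratedInDegree K u 2 (Ideal.span {u i} ⊓ Ideal.span {u j})

end CutIdeal

/-! A monomial of `R_G` is the exponent of a family of cuts, that is, the number of cuts together
with the number of times each edge is separated. The ideals in question are spanned by monomials, so
strong Koszulness is a statement about exponents: whenever `u_c m = u_d n` for distinct cuts `c` and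
`d`, some generator `u_{c'}` can be split off `m` with `u_c u_{c'} = u_d u_{d'}` for some `d'`
(`stronglyKoszul_toricGen_iff`). Taking the symmetric difference of all cuts with `c` reduces to the
case where `c` is the empty cut. Then `u_{c'} = u_d u_{d'} / s` means that `c'` separates every edge
separated by `d`, and the condition becomes the purely combinatorial property `Exchange`
(`stronglyKoszul_iff_exchange`).

Necessity: `Exchange` passes to contractions. In a connected graph the branch sets of a minor can be
enlarged to cover all vertices, so a `K₄` or `C₅` minor yields a contraction to `K₄`, or to a graph
on five vertices with a Hamiltonian cycle. Explicit families of cuts refute `Exchange` for `K₄` and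
for the pentagon with chords from one vertex; a pentagon with two crossing chords contracts to `K₄`.

Sufficiency: families of cuts can be glued along a cut vertex (`Exchange.union`), so only sets
without cut vertices matter. Without `K₄` and `C₅` minors these are `K_{2,n}` or `K_{1,1,n}`
(`exists_isDoubleStar`), up to single vertices. There the separation counts of families of `k` cuts
are described by parity, the triangle inequalities and a perimeter bound `2k`
(`exists_sepCount_eq`), and the cut to split off can be written down (`Exchange.doubleStar`). -/

namespace CutIdeal

/-! ### Separation counts and the exchange property under contraction -/

section Exchange

variable {V W : Type*}

/-- The number of members of the list `L` of two-colourings that separate `i` from `j`. -/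
def sepCount (L : List (V → Bool)) (i j : V) : ℕ :=
  L.countP fun A => A i != A j

@[simp] lemma sepCount_nil (i j : V) : sepCount ([] : List (V → Bool)) i j = 0 := rfl

lemma sepCount_cons (A : V → Bool) (L : List (V → Bool)) (i j : V) :
    sepCount (A :: L) i j = sepCount L i j + if A i = A j then 0 else 1 := by
  by_cases h : A i = A j <;> simp [sepCount, h]

lemma sepCount_append (L M : List (V → Bool)) (i j : V) :
    sepCount (L ++ M) i j = sepCount L i j + sepCount M i j := by
  simp [sepCount]

@[simp] lemma sepCount_self (L : List (V → Bool)) (i : V) : sepCount L i i = 0 := by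
  simp [sepCount]

lemma sepCount_comm (L : List (V → Bool)) (i j : V) : sepCount L i j = sepCount L j i := by
  simp only [sepCount, bne_comm]

lemma sepCount_le_length (L : List (V → Bool)) (i j : V) : sepCount L i j ≤ L.length :=
  List.countP_le_length

lemma sepCount_map_comp (L : List (W → Bool)) (f : V → W) (i j : V) :
    sepCount (L.map (· ∘ f)) i j = sepCount L (f i) (f j) := by
  simp [sepCount, List.countP_map, Function.comp_def]

lemma sepCount_congr {L : List (V → Bool)} {i j i' j' : V}
    (hi : ∀ A ∈ L, A i = A i') (hj : ∀ A ∈ L, A j = A j') :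
    sepCount L i j = sepCount L i' j' := by
  refine List.countP_congr fun A hA => ?_
  rw [hi A hA, hj A hA]

lemma eq_of_sepCount_eq_zero {L : List (V → Bool)} {i j : V} (h : sepCount L i j = 0) :
    ∀ A ∈ L, A i = A j := by
  intro A hA
  have := List.countP_eq_zero.mp h A hA
  simpa using this

/-- The parity condition and the metric inequalities satisfied by the separation counts of
three vertices. -/
lemma sepCount_triple (L : List (V → Bool)) (a b i : V) :
    (sepCount L a i + sepCount L b i + sepCount L a b) % 2 = 0 ∧
      sepCount L a b ≤ sepCount L a i + sepCount L b i ∧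
      sepCount L a i ≤ sepCount L b i + sepCount L a b ∧
      sepCount L b i ≤ sepCount L a i + sepCount L a b ∧
      sepCount L a i + sepCount L b i + sepCount L a b ≤ 2 * L.length := by
  induction L with
  | nil => simp
  | cons A L ih =>
    simp only [sepCount_cons, List.length_cons]
    cases A a <;> cases A b <;> cases A i <;>
      simp only [reduceCtorEq, if_true, if_false] <;> omega

/-- The exchange property of a graph with adjacency relation `r`: if a nonempty family `L` of cuts
has the same separation counts as `D` together with an equinumerous family `N`, then `L` can be
rewritten so as to contain a cut separating all edges that `D` separates. -/
def Exchange (r : V → V → Prop) : Prop :=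
  ∀ (D : V → Bool) (L N : List (V → Bool)), L ≠ [] → L.length = N.length →
    (∀ i j, r i j → sepCount L i j = sepCount (D :: N) i j) →
    ∃ (A : V → Bool) (L' : List (V → Bool)), L'.length + 1 = L.length ∧
      (∀ i j, r i j → sepCount L i j = sepCount (A :: L') i j) ∧
      ∀ i j, r i j → D i ≠ D j → A i ≠ A j

/-- It suffices to verify the exchange property for cuts separating some edge. -/
lemma Exchange.of_nontrivial {r : V → V → Prop}
    (h : ∀ (D : V → Bool) (L N : List (V → Bool)), L ≠ [] → L.length = N.length →
      (∀ i j, r i j → sepCount L i j = sepCount (D :: N) i j) →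
      (∃ i j, r i j ∧ D i ≠ D j) →
      ∃ (A : V → Bool) (L' : List (V → Bool)), L'.length + 1 = L.length ∧
        (∀ i j, r i j → sepCount L i j = sepCount (A :: L') i j) ∧
        ∀ i j, r i j → D i ≠ D j → A i ≠ A j) : Exchange r := by
  intro D L N hL hlen hcount
  by_cases hD : ∃ i j, r i j ∧ D i ≠ D j
  · exact h D L N hL hlen hcount hD
  · push Not at hD
    obtain ⟨A, L', rfl⟩ := List.exists_cons_of_ne_nil hL
    exact ⟨A, L', rfl, fun _ _ _ => rfl, fun i j hij hne => absurd (hD i j hij) hne⟩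

lemma Exchange.of_empty {r : V → V → Prop} (h : ∀ i j, ¬ r i j) : Exchange r :=
  .of_nontrivial fun _ _ _ _ _ _ ⟨i, j, hij, _⟩ => absurd hij (h i j)

lemma Exchange.comp_equiv {r : W → W → Prop} (h : Exchange r) (e : V ≃ W) :
    Exchange fun a b => r (e a) (e b) := by
  intro D L N hL hlen hcount
  have key : ∀ (M : List (V → Bool)) (i j : V),
      sepCount (M.map (· ∘ e.symm)) (e i) (e j) = sepCount M i j := by
    intro M i j; rw [sepCount_map_comp]; simp
  obtain ⟨A, L', h1, h2, h3⟩ := h (D ∘ e.symm) (L.map (· ∘ e.symm)) (N.map (· ∘ e.symm))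
    (by simpa using hL) (by simpa using hlen) (by
      intro i j hij
      have := hcount (e.symm i) (e.symm j) (by simpa using hij)
      rw [← key, ← key] at this
      simpa using this)
  refine ⟨A ∘ e, L'.map (· ∘ e), by simpa using h1, fun i j hij => ?_, fun i j hij hD => ?_⟩
  · rw [← key, h2 _ _ hij, ← sepCount_map_comp]; rfl
  · exact h3 _ _ hij (by simpa using hD)

/-- The exchange property passes to contractions. -/
lemma Exchange.contract {r : V → V → Prop} (h : Exchange r) (f : V → W)
    (hf : Function.Surjective f)
    (hconst : ∀ A : V → Bool, (∀ x y, r x y → f x = f y → A x = A y) →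
      ∀ x y, f x = f y → A x = A y) :
    Exchange fun a b : W => a ≠ b ∧ ∃ x y, f x = a ∧ f y = b ∧ r x y := by
  obtain ⟨g, hg⟩ := hf.hasRightInverse
  intro D L N hL hlen hcount
  have hLf : ∀ i j, r i j →
      sepCount (L.map (· ∘ f)) i j = sepCount ((D ∘ f) :: N.map (· ∘ f)) i j := by
    intro i j hij
    have : ((D ∘ f) :: N.map (· ∘ f)) = (D :: N).map (· ∘ f) := rfl
    rw [this, sepCount_map_comp, sepCount_map_comp]
    by_cases hfij : f i = f j
    · simp [hfij]
    · exact hcount _ _ ⟨hfij, i, j, rfl, rfl, hij⟩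
  obtain ⟨A, L', h1, h2, h3⟩ := h (D ∘ f) (L.map (· ∘ f)) (N.map (· ∘ f))
    (by simpa using hL) (by simpa using hlen) hLf
  -- Pulled-back cuts never separate the ends of an edge inside a fibre. The new family has the same
  -- counts, so its members are constant on fibres and descend along the section `g`.
  have hA : ∀ B ∈ A :: L', ∀ x, B x = B (g (f x)) := by
    intro B hB x
    refine hconst B (fun x y hxy hfxy => ?_) _ _ (hg _).symm
    refine eq_of_sepCount_eq_zero (L := A :: L') ?_ B hB
    rw [← h2 x y hxy, sepCount_map_comp, hfxy, sepCount_self]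
  refine ⟨A ∘ g, L'.map (· ∘ g), by simpa using h1, ?_, ?_⟩
  · rintro _ _ ⟨-, x, y, rfl, rfl, hxy⟩
    have : ((A ∘ g) :: L'.map (· ∘ g)) = (A :: L').map (· ∘ g) := rfl
    rw [this, sepCount_map_comp, ← sepCount_map_comp L, h2 x y hxy]
    exact sepCount_congr (fun B hB => hA B hB x) fun B hB => hA B hB y
  · rintro _ _ ⟨-, x, y, rfl, rfl, hxy⟩ hD
    have := h3 x y hxy hD
    rwa [hA A (by simp) x, hA A (by simp) y] at this

/-! ### Gluing cuts along a vertex -/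

open Classical in
/-- The cut that agrees with `A` on `S` and with `B` elsewhere, up to complementation, when the
two sides overlap in `v`. -/
noncomputable def glue (S : Set V) (v : V) (A B : V → Bool) : V → Bool :=
  fun i => if i ∈ S then A i ^^ A v else B i ^^ B v

lemma glue_left {S : Set V} {v : V} (A B : V → Bool) {i j : V} (hi : i ∈ S) (hj : j ∈ S) :
    glue S v A B i = glue S v A B j ↔ A i = A j := by
  simp [glue, hi, hj]

/-- The two prescriptions can clash on `T` only at `v`, where both give `false`. -/
lemma glue_right {S T : Set V} {v : V} (hST : S ∩ T ⊆ {v}) (A B : V → Bool) {i j : V}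
    (hi : i ∈ T) (hj : j ∈ T) : glue S v A B i = glue S v A B j ↔ B i = B j := by
  have h : ∀ k ∈ T, glue S v A B k = (B k ^^ B v) := by
    intro k hk
    by_cases hkS : k ∈ S
    · obtain rfl : k = v := hST ⟨hkS, hk⟩
      simp [glue]
    · simp [glue, hkS]
  rw [h i hi, h j hj, Bool.xor_left_inj]

lemma sepCount_zipWith_glue_left {S : Set V} {v : V} {i j : V} (hi : i ∈ S) (hj : j ∈ S) :
    ∀ {L M : List (V → Bool)}, L.length = M.length →
      sepCount (List.zipWith (glue S v) L M) i j = sepCount L i j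
  | [], [], _ => rfl
  | A :: L, B :: M, h => by
    simp only [List.zipWith_cons_cons, sepCount_cons, glue_left A B hi hj]
    rw [sepCount_zipWith_glue_left hi hj (by simpa using h)]

lemma sepCount_zipWith_glue_right {S T : Set V} {v : V} (hST : S ∩ T ⊆ {v}) {i j : V}
    (hi : i ∈ T) (hj : j ∈ T) :
    ∀ {L M : List (V → Bool)}, L.length = M.length →
      sepCount (List.zipWith (glue S v) L M) i j = sepCount M i j
  | [], [], _ => rfl
  | A :: L, B :: M, h => by
    simp only [List.zipWith_cons_cons, sepCount_cons, glue_right hST A B hi hj]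
    rw [sepCount_zipWith_glue_right hST hi hj (by simpa using h)]

/-- The exchange property is preserved when two graphs are glued along a vertex. -/
lemma Exchange.union {r r₁ r₂ : V → V → Prop} {S T : Set V} {v : V} (hST : S ∩ T ⊆ {v})
    (h₁ : Exchange r₁) (h₂ : Exchange r₂)
    (hr₁ : ∀ i j, r₁ i j → i ∈ S ∧ j ∈ S) (hr₂ : ∀ i j, r₂ i j → i ∈ T ∧ j ∈ T)
    (hr : ∀ i j, r i j ↔ r₁ i j ∨ r₂ i j) : Exchange r := by
  intro D L N hL hlen hcount
  obtain ⟨A, L', a1, a2, a3⟩ :=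
    h₁ D L N hL hlen fun i j hij => hcount i j ((hr i j).2 (.inl hij))
  obtain ⟨B, M', b1, b2, b3⟩ :=
    h₂ D L N hL hlen fun i j hij => hcount i j ((hr i j).2 (.inr hij))
  have hl : (A :: L').length = (B :: M').length := by simp; omega
  -- The cuts of the two families may be paired in any order, since each edge is counted on one side
  -- only; equal lengths ensure that none is lost.
  refine ⟨glue S v A B, List.zipWith (glue S v) L' M', ?_, ?_, ?_⟩
  · simp; omega
  · intro i j hij
    rw [← List.zipWith_cons_cons]
    rcases (hr i j).1 hij with h | h
    · rw [sepCount_zipWith_glue_left (hr₁ i j h).1 (hr₁ i j h).2 hl, a2 i j h]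
    · rw [sepCount_zipWith_glue_right hST (hr₂ i j h).1 (hr₂ i j h).2 hl, b2 i j h]
  · intro i j hij hD
    rcases (hr i j).1 hij with h | h
    · rw [Ne, glue_left A B (hr₁ i j h).1 (hr₁ i j h).2]
      exact a3 i j h hD
    · rw [Ne, glue_right hST A B (hr₂ i j h).1 (hr₂ i j h).2]
      exact b3 i j h hD

/-! ### The exchange property of double stars -/

lemma countP_range_lt (m : ℕ) : ∀ n, (List.range n).countP (fun l => decide (l < m)) = min m n
  | 0 => by simp
  | n + 1 => by
    rw [List.range_succ, List.countP_append, countP_range_lt m n]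
    by_cases h : n < m <;> simp [h] <;> omega

lemma countP_range_not_lt (m : ℕ) :
    ∀ n, (List.range n).countP (fun l => !decide (l < m)) = n - m
  | 0 => by simp
  | n + 1 => by
    rw [List.range_succ, List.countP_append, countP_range_not_lt m n]
    by_cases h : n < m <;> simp [h] <;> omega

/-- The metric inequalities and the parity condition suffice for separation counts on a graph
whose edges all meet `{a, b}`. -/
lemma exists_sepCount_eq {a b : V} (hab : a ≠ b) {k z : ℕ} (hz : z ≤ k) (I : Set V)
    (haI : a ∉ I) (hbI : b ∉ I) (p q : V → ℕ)
    (h : ∀ i ∈ I, (p i + q i + z) % 2 = 0 ∧ z ≤ p i + q i ∧ p i ≤ q i + z ∧ q i ≤ p i + z ∧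
      p i + q i + z ≤ 2 * k) :
    ∃ L : List (V → Bool), L.length = k ∧ sepCount L a b = z ∧
      ∀ i ∈ I, sepCount L a i = p i ∧ sepCount L b i = q i := by
  classical
  -- The first `z` cuts separate `a` from `b`, the other `k - z` do not. The vertex `i` is put apart
  -- from `a` in `(p + z - q) / 2` cuts of the first kind and in `(p + q - z) / 2` of the second;
  -- the hypotheses say that these numbers are integers within range. Different `i` do not interact,
  -- as no count between them is prescribed.
  let f₁ : ℕ → V → Bool := fun l i =>
    if i = a then false else if i = b then true else decide (l < (p i + z - q i) / 2)
  let f₂ : ℕ → V → Bool := fun l i =>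
    if i = a then false else if i = b then false else decide (l < (p i + q i - z) / 2)
  have e₁ : ∀ (i j n), sepCount ((List.range n).map f₁) i j =
      (List.range n).countP fun l => f₁ l i != f₁ l j := by
    intro i j n; simp [sepCount, List.countP_map, Function.comp_def]
  have e₂ : ∀ (i j n), sepCount ((List.range n).map f₂) i j =
      (List.range n).countP fun l => f₂ l i != f₂ l j := by
    intro i j n; simp [sepCount, List.countP_map, Function.comp_def]
  refine ⟨(List.range z).map f₁ ++ (List.range (k - z)).map f₂, ?_, ?_, fun i hi => ?_⟩
  · simp; omega
  · rw [sepCount_append, e₁, e₂]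
    simp [f₁, f₂, hab.symm]
  · have hia : i ≠ a := fun e => haI (e ▸ hi)
    have hib : i ≠ b := fun e => hbI (e ▸ hi)
    have := h i hi
    rw [sepCount_append, sepCount_append, e₁, e₁, e₂, e₂]
    simp only [f₁, f₂, hia, hib, hab.symm, if_true, if_false, Bool.false_bne, Bool.true_bne,
      countP_range_lt, countP_range_not_lt]
    omega

/-- The graphs `K_{2,n}` and `K_{1,1,n}` with possible isolated vertices have the exchange
property. -/
lemma Exchange.doubleStar {r : V → V → Prop} {a b : V} (hab : a ≠ b)
    (hsymm : ∀ i j, r i j → r j i) (hirr : ∀ i, ¬ r i i)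
    (hcover : ∀ i j, r i j → i = a ∨ i = b ∨ j = a ∨ j = b)
    (hboth : ∀ i, i ≠ a → i ≠ b → (r a i ↔ r b i)) : Exchange r := by
  have hred : ∀ P : V → V → Prop, (∀ i j, P i j → P j i) → (r a b → P a b) →
      (∀ i, i ≠ a → i ≠ b → r a i → P a i) → (∀ i, i ≠ a → i ≠ b → r a i → P b i) →
      ∀ i j, r i j → P i j := by
    intro P hP h1 h2 h3 i j hij
    have main : ∀ i j, r i j → (i = a ∨ i = b) → P i j := by
      rintro i j hij (rfl | rfl)
      · by_cases hjb : j = b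
        · subst hjb; exact h1 hij
        · exact h2 j (fun e => hirr _ (e ▸ hij)) hjb hij
      · by_cases hja : j = a
        · subst hja; exact hP _ _ (h1 (hsymm _ _ hij))
        · have hjb : j ≠ i := fun e => hirr _ (e ▸ hij)
          exact h3 j hja hjb ((hboth j hja hjb).2 hij)
    rcases hcover i j hij with h | h | h | h
    · exact main i j hij (.inl h)
    · exact main i j hij (.inr h)
    · exact hP _ _ (main j i (hsymm _ _ hij) (.inl h))
    · exact hP _ _ (main j i (hsymm _ _ hij) (.inr h))
  refine .of_nontrivial fun D L N hL hlen hcount hD => ?_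
  have hsep : ∀ M M' : List (V → Bool), (r a b → sepCount M a b = sepCount M' a b) →
      (∀ i, i ≠ a → i ≠ b → r a i → sepCount M a i = sepCount M' a i) →
      (∀ i, i ≠ a → i ≠ b → r a i → sepCount M b i = sepCount M' b i) →
      ∀ i j, r i j → sepCount M i j = sepCount M' i j := fun M M' =>
    hred (fun i j => sepCount M i j = sepCount M' i j) fun i j h => by
      rw [sepCount_comm M, sepCount_comm M', h]
  have hsub : ∀ A : V → Bool, (r a b → D a ≠ D b → A a ≠ A b) →
      (∀ i, i ≠ a → i ≠ b → r a i → D a ≠ D i → A a ≠ A i) →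
      (∀ i, i ≠ a → i ≠ b → r a i → D b ≠ D i → A b ≠ A i) →
      ∀ i j, r i j → D i ≠ D j → A i ≠ A j := fun A =>
    hred (fun i j => D i ≠ D j → A i ≠ A j) fun i j h hD => (h hD.symm).symm
  have hk : 0 < L.length := List.length_pos_iff.2 hL
  set I : Set V := {i | i ≠ a ∧ i ≠ b ∧ r a i} with hI
  have haI : a ∉ I := fun h => h.1 rfl
  have hbI : b ∉ I := fun h => h.2.1 rfl
  have hcab : r a b → sepCount L a b = sepCount N a b + if D a = D b then 0 else 1 :=
    fun h => by rw [hcount a b h, sepCount_cons]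
  have hca : ∀ i ∈ I, sepCount L a i = sepCount N a i + if D a = D i then 0 else 1 :=
    fun i hi => by rw [hcount a i hi.2.2, sepCount_cons]
  have hcb : ∀ i ∈ I, sepCount L b i = sepCount N b i + if D b = D i then 0 else 1 :=
    fun i hi => by rw [hcount b i ((hboth i hi.1 hi.2.1).1 hi.2.2), sepCount_cons]
  have hzL := sepCount_le_length L a b
  have hzN := sepCount_le_length N a b
  by_cases hDab : D a = D b
  · -- `D` does not separate `a` and `b`
    obtain ⟨z, hz⟩ : ∃ z, z = min (sepCount L a b) (sepCount N a b) := ⟨_, rfl⟩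
    -- If `z` were the full length `k`, a vertex `i` separated from `a` by `D` would have counts to
    -- `a` and `b` in `L` with sum at least `k + 2`, by the triangle inequality in `N`, and at most
    -- `k`, by the perimeter bound in `L`.
    have hzk : z < L.length := by
      by_contra hcon
      have hno : ∀ i ∈ I, D a = D i := by
        intro i hi
        by_contra hne
        have h1 := sepCount_triple L a b i
        have h2 := sepCount_triple N a b i
        have h3 := hca i hi
        have h4 := hcb i hi
        rw [← hDab] at h4
        simp only [hne, if_false] at h3 h4
        omega
      obtain ⟨i, j, hij, hne⟩ := hD
      exact hred (fun i j => D i = D j) (fun _ _ => Eq.symm) (fun _ => hDab)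
        (fun i h1 h2 h3 => hno i ⟨h1, h2, h3⟩) (fun i h1 h2 h3 => hDab ▸ hno i ⟨h1, h2, h3⟩)
        i j hij |> hne
    classical
    -- Besides the vertices that `D` cuts off, those with perimeter exactly `2k` must be cut off,
    -- since the remaining `k - 1` cuts only allow `2(k - 1)`.
    let A : V → Bool := fun i => if i = a ∨ i = b then false else
      (D i != D a) || decide (sepCount L a i + sepCount L b i + z = 2 * L.length)
    have hAa : A a = false := by simp [A]
    have hAb : A b = false := by simp [A]
    have hAi : ∀ i ∈ I, A i = ((D i != D a) ||
        decide (sepCount L a i + sepCount L b i + z = 2 * L.length)) := fun i hi => by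
      simp [A, hi.1, hi.2.1]
    -- The minimum `z` respects the differences of counts in both `L` and `N`. When `1` is
    -- subtracted, the sum stays at least `z` by the triangle inequality in `N` if `D` cuts off `i`,
    -- and by `z < k` if the perimeter is `2k`.
    obtain ⟨L', hl', hab', hi'⟩ := exists_sepCount_eq hab (k := L.length - 1) (z := z) (by omega) I
      haI hbI (fun i => sepCount L a i - if A i then 1 else 0)
      (fun i => sepCount L b i - if A i then 1 else 0) (fun i hi => by
        have h1 := sepCount_triple L a b i
        have h2 := sepCount_triple N a b i
        have h3 := hca i hi
        have h4 := hcb i hi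
        rw [← hDab] at h4
        rw [hAi i hi]
        by_cases hne : D a = D i
        · by_cases h5 : sepCount L a i + sepCount L b i + z = 2 * L.length
          · simp [hne, h5] at h3 h4 ⊢; omega
          · simp [hne, h5] at h3 h4 ⊢; omega
        · simp [hne, Ne.symm hne] at h3 h4 ⊢; omega)
    have hpos : ∀ i ∈ I, A i = true → 1 ≤ sepCount L a i ∧ 1 ≤ sepCount L b i := by
      intro i hi hA
      have h1 := sepCount_triple L a b i
      have h2 := sepCount_triple N a b i
      have h3 := hca i hi
      have h4 := hcb i hi
      rw [← hDab] at h4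
      rw [hAi i hi] at hA
      by_cases hne : D a = D i
      · by_cases h5 : sepCount L a i + sepCount L b i + z = 2 * L.length
        · simp [hne] at h3 h4; omega
        · simp [hne, h5] at hA
      · simp [hne] at h3 h4; omega
    refine ⟨A, L', by omega, hsep _ _ (fun h => ?_) (fun i h1 h2 h3 => ?_) (fun i h1 h2 h3 => ?_),
      hsub _ (fun _ h => absurd hDab h) (fun i h1 h2 h3 h4 => ?_) (fun i h1 h2 h3 h4 => ?_)⟩
    · have := hcab h
      rw [sepCount_cons, hAa, hAb, hab', hz]
      simp [hDab] at this ⊢; omega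
    · have := hpos i ⟨h1, h2, h3⟩
      rw [sepCount_cons, hAa, (hi' i ⟨h1, h2, h3⟩).1]
      cases hA : A i
      · simp
      · have := (this hA).1
        simp; omega
    · have := hpos i ⟨h1, h2, h3⟩
      rw [sepCount_cons, hAb, (hi' i ⟨h1, h2, h3⟩).2]
      cases hA : A i
      · simp
      · have := (this hA).2
        simp; omega
    · rw [hAa, hAi i ⟨h1, h2, h3⟩]; simp [h4.symm]
    · rw [hAb, hAi i ⟨h1, h2, h3⟩]; simp [hDab, h4.symm]
  have hDi : ∀ i, (D a = D i ∧ D b ≠ D i) ∨ (D a ≠ D i ∧ D b = D i) := by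
    intro i
    revert hDab
    generalize D a = x, D b = y, D i = w
    revert x y w
    decide
  by_cases hz : sepCount N a b + 1 ≤ sepCount L a b
  · -- `D` itself can be split off
    obtain ⟨L', hl', hab', hi'⟩ := exists_sepCount_eq hab (k := L.length - 1)
      (z := sepCount N a b) (by omega) I haI hbI (sepCount N a) (sepCount N b) (fun i hi => by
        -- `D` separates `i` from exactly one of `a` and `b`, so the perimeter in `N` is at least
        -- two below the one in `L`, which leaves room for only `k - 1` cuts.
        have h1 := sepCount_triple L a b i
        have h2 := sepCount_triple N a b i
        have h3 := hca i hi
        have h4 := hcb i hi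
        rcases hDi i with h | h
        · rw [if_pos h.1] at h3; rw [if_neg h.2] at h4; omega
        · rw [if_neg h.1] at h3; rw [if_pos h.2] at h4; omega)
    refine ⟨D, L', by omega, hsep _ _ (fun h => ?_) (fun i h1 h2 h3 => ?_) (fun i h1 h2 h3 => ?_),
      fun _ _ _ h => h⟩
    · rw [hcab h, sepCount_cons, hab']
    · rw [hca i ⟨h1, h2, h3⟩, sepCount_cons, (hi' i ⟨h1, h2, h3⟩).1]
    · rw [hcb i ⟨h1, h2, h3⟩, sepCount_cons, (hi' i ⟨h1, h2, h3⟩).2]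
  · -- the cut with parts `{a, b}` and its complement can be split off
    have hrab : ¬ r a b := fun h => by
      have := hcab h
      simp [hDab] at this; omega
    -- The count of `a, b` in `L` does not exceed that in `N`, so the triangle inequality in `N`
    -- gives a surplus of one, and parity makes it two. Hence both counts of `i` can drop by one.
    have hineq : ∀ i ∈ I, sepCount L a i + sepCount L b i ≥ sepCount L a b + 2 := by
      intro i hi
      have h1 := sepCount_triple L a b i
      have h2 := sepCount_triple N a b i
      have h3 := hca i hi
      have h4 := hcb i hi
      rcases hDi i with h | h
      · rw [if_pos h.1] at h3; rw [if_neg h.2] at h4; omega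
      · rw [if_neg h.1] at h3; rw [if_pos h.2] at h4; omega
    obtain ⟨i₀, hi₀⟩ : ∃ i, i ∈ I := by
      by_contra! hcon
      obtain ⟨i, j, hij, -⟩ := hD
      exact hred (fun _ _ => False) (fun _ _ => id) hrab
        (fun i h1 h2 h3 => hcon i ⟨h1, h2, h3⟩) (fun i h1 h2 h3 => hcon i ⟨h1, h2, h3⟩) i j hij
    have hz' : sepCount L a b ≤ L.length - 1 := by
      have h1 := sepCount_triple L a b i₀
      have h2 := hineq i₀ hi₀
      omega
    obtain ⟨L', hl', hab', hi'⟩ := exists_sepCount_eq hab (k := L.length - 1)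
      (z := sepCount L a b) hz' I haI hbI (fun i => sepCount L a i - 1)
      (fun i => sepCount L b i - 1) (fun i hi => by
        have h1 := sepCount_triple L a b i
        have h2 := hineq i hi
        omega)
    classical
    refine ⟨fun i => decide (i = a ∨ i = b), L', by omega,
      hsep _ _ (fun h => absurd h hrab) (fun i h1 h2 h3 => ?_) (fun i h1 h2 h3 => ?_),
      hsub _ (fun h => absurd h hrab) (fun i h1 h2 h3 h4 => ?_) (fun i h1 h2 h3 h4 => ?_)⟩
    · have h5 := sepCount_triple L a b i
      have h6 := hineq i ⟨h1, h2, h3⟩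
      rw [sepCount_cons, (hi' i ⟨h1, h2, h3⟩).1]
      simp [h1, h2]; omega
    · have h5 := sepCount_triple L a b i
      have h6 := hineq i ⟨h1, h2, h3⟩
      rw [sepCount_cons, (hi' i ⟨h1, h2, h3⟩).2]
      simp [h1, h2]; omega
    · simp [h1, h2]
    · simp [h1, h2]

/-! ### Graphs without the exchange property -/

/-- `K₄` does not have the exchange property. -/
lemma not_exchange_of_complete {r : Fin 4 → Fin 4 → Prop} (hr : ∀ i j, i ≠ j → r i j) :
    ¬ Exchange r := by
  intro h
  -- `L` consists of the three balanced cuts, `D` and `N` of the four cuts isolating a vertex; both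
  -- families separate every edge twice. The cut `A` must isolate `3`, so two cuts remain to
  -- separate each edge of the triangle `0, 1, 2` twice. This is impossible, as a cut separates at
  -- most two edges of a triangle.
  obtain ⟨A, L', h1, h2, h3⟩ := h ![false, false, false, true]
    [![false, false, true, true], ![false, true, false, true], ![false, true, true, false]]
    [![false, false, true, false], ![false, true, false, false], ![false, true, true, true]]
    (by simp) rfl (fun i j hij => by clear hij; revert i j; decide)
  have a1 := h3 0 3 (hr _ _ (by decide)) (by decide)
  have a2 := h3 1 3 (hr _ _ (by decide)) (by decide)
  have a3 := h3 2 3 (hr _ _ (by decide)) (by decide)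
  have c1 := h2 0 1 (hr _ _ (by decide))
  have c2 := h2 0 2 (hr _ _ (by decide))
  have c3 := h2 1 2 (hr _ _ (by decide))
  have e1 : A 0 = A 1 := by
    clear c1 c2 c3; revert a1 a2
    cases A 0 <;> cases A 1 <;> cases A 3 <;> simp
  have e2 : A 0 = A 2 := by
    clear c1 c2 c3; revert a1 a3
    cases A 0 <;> cases A 2 <;> cases A 3 <;> simp
  have t := sepCount_triple L' 0 1 2
  rw [sepCount_cons A L'] at c1 c2 c3
  simp only [← e1, ← e2, if_true] at c1 c2 c3
  have d1 : sepCount L' 0 1 = 2 := by rw [← add_zero (sepCount L' 0 1), ← c1]; decide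
  have d2 : sepCount L' 0 2 = 2 := by rw [← add_zero (sepCount L' 0 2), ← c2]; decide
  have d3 : sepCount L' 1 2 = 2 := by rw [← add_zero (sepCount L' 1 2), ← c3]; decide
  simp only [List.length_cons, List.length_nil] at h1
  omega

/-- A pentagon, possibly with chords from the vertex `0`, does not have the exchange property. -/
lemma not_exchange_of_fan {r : Fin 5 → Fin 5 → Prop} (hr : ∀ i, r i (i + 1))
    (h13 : ∀ i j, r i j → i = 0 ∨ j = 0 ∨ j = i + 1 ∨ i = j + 1) : ¬ Exchange r := by
  intro h
  -- `D` separates all edges of the pentagon except `23`, so by parity `A` cannot separate `23`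
  -- either. Both cuts of `L` separate `23`, but only one cut remains in `L'`. The chords `02` and
  -- `03` are separated once by either family.
  obtain ⟨A, L', h1, h2, h3⟩ := h ![false, true, false, false, true]
    [![false, false, true, false, true], ![false, true, false, true, true]]
    [![false, false, false, true, true], ![false, false, true, false, false]]
    (by simp) rfl (fun i j hij => by
      have := h13 i j hij
      clear hij
      revert i j; decide)
  have a1 : A 0 ≠ A 1 := h3 0 1 (hr 0) (by decide)
  have a2 : A 1 ≠ A 2 := h3 1 2 (hr 1) (by decide)
  have a3 : A 3 ≠ A 4 := h3 3 4 (hr 3) (by decide)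
  have a4 : A 4 ≠ A 0 := h3 4 0 (hr 4) (by decide)
  have e : A 2 = A 3 := by
    revert a1 a2 a3 a4
    cases A 0 <;> cases A 1 <;> cases A 2 <;> cases A 3 <;> cases A 4 <;> simp
  have c : _ = sepCount (A :: L') 2 3 := h2 2 3 (hr 2)
  rw [sepCount_cons A L', if_pos e] at c
  have d : sepCount L' 2 3 = 2 := by rw [← add_zero (sepCount L' 2 3), ← c]; decide
  have := sepCount_le_length L' 2 3
  simp only [List.length_cons, List.length_nil] at h1
  omega

/-- A pentagon with two crossing chords does not have the exchange property, since it can be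
contracted to `K₄`. -/
lemma not_exchange_of_crossing {r : Fin 5 → Fin 5 → Prop} (hsymm : ∀ i j, r i j → r j i)
    (hr : ∀ i, r i (i + 1)) (h02 : r 0 2) (h13 : r 1 3) : ¬ Exchange r := by
  intro h
  -- The edge `40` is contracted; the edge `43` then joins the classes of `0` and `3`.
  refine not_exchange_of_complete ?_ (h.contract ![0, 1, 2, 3, 0] (by decide) ?_)
  · have hs : ∀ i j : Fin 4,
        (∃ x y, (![0, 1, 2, 3, 0] : Fin 5 → Fin 4) x = i ∧
          (![0, 1, 2, 3, 0] : Fin 5 → Fin 4) y = j ∧ r x y) →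
        ∃ x y, (![0, 1, 2, 3, 0] : Fin 5 → Fin 4) x = j ∧
          (![0, 1, 2, 3, 0] : Fin 5 → Fin 4) y = i ∧ r x y :=
      fun i j ⟨x, y, hx, hy, hxy⟩ => ⟨y, x, hy, hx, hsymm _ _ hxy⟩
    have main : ∀ i j : Fin 4, i < j →
        ∃ x y, (![0, 1, 2, 3, 0] : Fin 5 → Fin 4) x = i ∧
          (![0, 1, 2, 3, 0] : Fin 5 → Fin 4) y = j ∧ r x y := by
      intro i j hij
      fin_cases i <;> fin_cases j <;> first | exact absurd hij (by decide) | skip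
      · exact ⟨0, 1, rfl, rfl, hr 0⟩
      · exact ⟨0, 2, rfl, rfl, h02⟩
      · exact ⟨4, 3, rfl, rfl, hsymm _ _ (hr 3)⟩
      · exact ⟨1, 2, rfl, rfl, hr 1⟩
      · exact ⟨1, 3, rfl, rfl, h13⟩
      · exact ⟨2, 3, rfl, rfl, hr 2⟩
    intro i j hij
    refine ⟨hij, ?_⟩
    rcases lt_or_gt_of_ne hij with h | h
    · exact main i j h
    · exact hs _ _ (main j i h)
  · intro A hA
    have h40 := hA 4 0 (hr 4) rfl
    have : ∀ x y : Fin 5, (![0, 1, 2, 3, 0] : Fin 5 → Fin 4) x = ![0, 1, 2, 3, 0] y →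
        x = y ∨ (x = 4 ∧ y = 0) ∨ (x = 0 ∧ y = 4) := by decide
    intro x y hxy
    rcases this x y hxy with rfl | ⟨rfl, rfl⟩ | ⟨rfl, rfl⟩
    · rfl
    · exact h40
    · exact h40.symm

/-- No graph on five vertices with a Hamiltonian cycle has the exchange property. -/
lemma not_exchange_of_pentagon {r : Fin 5 → Fin 5 → Prop} (hsymm : ∀ i j, r i j → r j i)
    (hirr : ∀ i, ¬ r i i) (hr : ∀ i, r i (i + 1)) : ¬ Exchange r := by
  intro h
  have hrot : ∀ c, Exchange fun a b => r (a + c) (b + c) :=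
    fun c => h.comp_equiv (Equiv.addRight c)
  have hr' : ∀ c i, r (i + c) (i + 1 + c) := fun c i => by
    rw [add_right_comm]; exact hr _
  have hcross : ∀ c, ¬ (r c (2 + c) ∧ r (1 + c) (3 + c)) := fun c ⟨h1, h2⟩ =>
    not_exchange_of_crossing (r := fun a b => r (a + c) (b + c)) (fun _ _ => hsymm _ _) (hr' c)
      (by simpa using h1) h2 (hrot c)
  -- Two chords of a pentagon cross unless they share an end. Pairwise non-crossing chords therefore
  -- all meet one vertex `c`, since no three chords form a triangle.
  obtain ⟨c, hc⟩ : ∃ c : Fin 5,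
      ¬ r (1 + c) (3 + c) ∧ ¬ r (2 + c) (4 + c) ∧ ¬ r (4 + c) (1 + c) := by
    have q0 : ¬ (r 0 2 ∧ r 1 3) := hcross 0
    have q1 : ¬ (r 1 3 ∧ r 2 4) := hcross 1
    have q2 : ¬ (r 2 4 ∧ r 3 0) := hcross 2
    have q3 : ¬ (r 3 0 ∧ r 4 1) := hcross 3
    have q4 : ¬ (r 4 1 ∧ r 0 2) := hcross 4
    by_contra hcon
    rw [not_exists] at hcon
    have p0 : ¬ (¬ r 1 3 ∧ ¬ r 2 4 ∧ ¬ r 4 1) := hcon 0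
    have p1 : ¬ (¬ r 2 4 ∧ ¬ r 3 0 ∧ ¬ r 0 2) := hcon 1
    have p2 : ¬ (¬ r 3 0 ∧ ¬ r 4 1 ∧ ¬ r 1 3) := hcon 2
    have p3 : ¬ (¬ r 4 1 ∧ ¬ r 0 2 ∧ ¬ r 2 4) := hcon 3
    have p4 : ¬ (¬ r 0 2 ∧ ¬ r 1 3 ∧ ¬ r 3 0) := hcon 4
    clear hcross hr' hrot h
    grind
  refine not_exchange_of_fan (r := fun a b => r (a + c) (b + c)) (hr' c) ?_ (hrot c)
  intro i j hij
  have hji := hsymm _ _ hij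
  by_contra hcon
  have hne : i ≠ j := fun e => hirr _ (e ▸ hij)
  have : (i = 1 ∧ j = 3) ∨ (i = 3 ∧ j = 1) ∨ (i = 2 ∧ j = 4) ∨ (i = 4 ∧ j = 2) ∨
      (i = 4 ∧ j = 1) ∨ (i = 1 ∧ j = 4) := by
    clear hij hji
    revert i j; decide
  rcases this with ⟨rfl, rfl⟩ | ⟨rfl, rfl⟩ | ⟨rfl, rfl⟩ | ⟨rfl, rfl⟩ | ⟨rfl, rfl⟩ | ⟨rfl, rfl⟩
  exacts [hc.1 hij, hc.1 hji, hc.2.1 hij, hc.2.1 hji, hc.2.2 hij, hc.2.2 hji]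

end Exchange

/-! ### Connected vertex sets and branch sets -/

section ConnSet

variable {V : Type*} {G : SimpleGraph V}

/-- The set `S` is nonempty and induces a connected subgraph: every nonempty proper subset of `S`
is left by an edge inside `S`. -/
def ConnSet (G : SimpleGraph V) (S : Set V) : Prop :=
  S.Nonempty ∧ ∀ T ⊆ S, T.Nonempty → T ≠ S → ∃ x ∈ T, ∃ y ∈ S, y ∉ T ∧ G.Adj x y

/-- The description by boundary edges avoids walks in subtypes and behaves well under unions and
differences of sets. -/
lemma connSet_iff {S : Set V} : ConnSet G S ↔ (G.induce S).Connected := by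
  constructor
  · rintro ⟨⟨x₀, hx₀⟩, h⟩
    have key : ∀ y : S, (G.induce S).Reachable ⟨x₀, hx₀⟩ y := by
      by_contra! hcon
      obtain ⟨y, hy⟩ := hcon
      obtain ⟨x, ⟨hx, hxr⟩, z, hz, hzn, hxz⟩ :=
        h {x | ∃ hx : x ∈ S, (G.induce S).Reachable ⟨x₀, hx₀⟩ ⟨x, hx⟩} (fun x hx => hx.1)
          ⟨x₀, hx₀, .rfl⟩ (fun e => by
            exact hy (e.ge y.2).2)
      exact hzn ⟨hz, hxr.trans (SimpleGraph.Adj.reachable (by simpa using hxz))⟩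
    exact { preconnected := fun x y => (key x).symm.trans (key y), nonempty := ⟨⟨x₀, hx₀⟩⟩ }
  · intro h
    obtain ⟨x₀, hx₀⟩ := h.nonempty
    refine ⟨⟨x₀, hx₀⟩, fun T hT hTne hTS => ?_⟩
    obtain ⟨t, ht⟩ := hTne
    obtain ⟨s, hs, hsT⟩ := Set.exists_of_ssubset (hT.ssubset_of_ne hTS)
    obtain ⟨p⟩ := h.preconnected ⟨t, hT ht⟩ ⟨s, hs⟩
    obtain ⟨d, -, hd1, hd2⟩ := p.exists_boundary_dart (Subtype.val ⁻¹' T) ht hsT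
    exact ⟨d.fst, hd1, d.snd, d.snd.2, hd2, by simpa using d.adj⟩

lemma connSet_singleton (v : V) : ConnSet G {v} := by
  refine ⟨⟨v, rfl⟩, fun T hT hne hne' => ?_⟩
  exact absurd ((Set.subset_singleton_iff_eq.1 hT).resolve_left hne.ne_empty) hne'

lemma ConnSet.union {S T : Set V} (hS : ConnSet G S) (hT : ConnSet G T) {x y : V} (hx : x ∈ S)
    (hy : y ∈ T) (hxy : G.Adj x y) : ConnSet G (S ∪ T) := by
  refine ⟨⟨x, .inl hx⟩, fun U hU hUne hUn => ?_⟩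
  by_cases h1 : (U ∩ S).Nonempty ∧ U ∩ S ≠ S
  · obtain ⟨u, hu, w, hw, hwn, huw⟩ := hS.2 _ Set.inter_subset_right h1.1 h1.2
    exact ⟨u, hu.1, w, .inl hw, fun h => hwn ⟨h, hw⟩, huw⟩
  by_cases h2 : (U ∩ T).Nonempty ∧ U ∩ T ≠ T
  · obtain ⟨u, hu, w, hw, hwn, huw⟩ := hT.2 _ Set.inter_subset_right h2.1 h2.2
    exact ⟨u, hu.1, w, .inr hw, fun h => hwn ⟨h, hw⟩, huw⟩
  have h1' : x ∉ U → ∀ u ∈ U, u ∉ S := fun hxU u hu huS =>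
    h1 ⟨⟨u, hu, huS⟩, fun e => hxU (e.ge hx).1⟩
  have h1'' : x ∈ U → S ⊆ U := fun hxU => by
    by_contra hcon
    exact h1 ⟨⟨x, hxU, hx⟩, fun e => hcon (Set.inter_eq_right.1 e)⟩
  have h2' : y ∉ U → ∀ u ∈ U, u ∉ T := fun hyU u hu huT =>
    h2 ⟨⟨u, hu, huT⟩, fun e => hyU (e.ge hy).1⟩
  have h2'' : y ∈ U → T ⊆ U := fun hyU => by
    by_contra hcon
    exact h2 ⟨⟨y, hyU, hy⟩, fun e => hcon (Set.inter_eq_right.1 e)⟩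
  by_cases hxU : x ∈ U <;> by_cases hyU : y ∈ U
  · exact absurd (hU.antisymm (Set.union_subset (h1'' hxU) (h2'' hyU))) hUn
  · exact ⟨x, hxU, y, .inr hy, hyU, hxy⟩
  · exact ⟨y, hyU, x, .inl hx, hxU, hxy.symm⟩
  · obtain ⟨u, hu⟩ := hUne
    exact absurd (hU hu) (by simp [h1' hxU u hu, h2' hyU u hu])

protected lemma ConnSet.insert {S : Set V} (hS : ConnSet G S) {x y : V} (hx : x ∈ S)
    (hxy : G.Adj x y) : ConnSet G (insert y S) := by
  rw [Set.insert_eq, Set.union_comm]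
  exact hS.union (connSet_singleton y) hx rfl hxy

/-- A function constant along the edges of a connected set is constant on it. -/
lemma ConnSet.eq_of_forall_adj {S : Set V} (hS : ConnSet G S) {A : V → Bool}
    (hA : ∀ x ∈ S, ∀ y ∈ S, G.Adj x y → A x = A y) {x y : V} (hx : x ∈ S) (hy : y ∈ S) :
    A x = A y := by
  by_contra hne
  obtain ⟨u, hu, w, hw, hwn, huw⟩ := hS.2 {z | z ∈ S ∧ A z = A x} (fun z hz => hz.1)
    ⟨x, hx, rfl⟩ (fun e => hne (e.ge hy).2.symm)
  exact hwn ⟨hw, (hA u hu.1 w hw huw).symm.trans hu.2⟩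

/-- If no edge leads from `T` to the rest of `S \ {v}`, then `T` together with `v` is connected. -/
lemma ConnSet.insert_of_separated {S T : Set V} (hS : ConnSet G S) {v : V} (hv : v ∈ S)
    (hT : T ⊆ S \ {v}) (hsep : ∀ x ∈ T, ∀ y ∈ S \ {v}, y ∉ T → ¬ G.Adj x y) :
    ConnSet G (insert v T) := by
  have hsub : insert v T ⊆ S := Set.insert_subset hv fun x hx => (hT hx).1
  have key : ∀ U ⊆ T, U.Nonempty → ∃ x ∈ U, ∃ y ∈ insert v T, y ∉ U ∧ G.Adj x y := by
    intro U hU hUne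
    obtain ⟨x, hx, y, hy, hyU, hxy⟩ := hS.2 U (fun x hx => (hT (hU hx)).1) hUne
      (fun e => (hT (hU (e ▸ hv : v ∈ U))).2 rfl)
    refine ⟨x, hx, y, ?_, hyU, hxy⟩
    by_contra hcon
    rw [Set.mem_insert_iff, not_or] at hcon
    exact hsep x (hU hx) y ⟨hy, hcon.1⟩ hcon.2 hxy
  refine ⟨⟨v, .inl rfl⟩, fun U hU hUne hUn => ?_⟩
  by_cases hvU : v ∈ U
  · obtain ⟨s, hs, hsU⟩ := Set.exists_of_ssubset (hU.ssubset_of_ne hUn)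
    obtain ⟨x, hx, y, hy, hyn, hxy⟩ := key (insert v T \ U)
      (fun x hx => hx.1.resolve_left fun e => hx.2 (e ▸ hvU)) ⟨s, hs, hsU⟩
    exact ⟨y, by_contra fun h => hyn ⟨hy, h⟩, x, hx.1, hx.2, hxy.symm⟩
  · exact key U (fun x hx => (hU hx).resolve_left fun e => hvU (e ▸ hx)) hUne

/-- Two distinct vertices of a connected set can be separated into two connected parts. -/
lemma ConnSet.exists_split [Finite V] {C : Set V} (hC : ConnSet G C) {p q : V} (hp : p ∈ C)
    (hq : q ∈ C) (hpq : p ≠ q) :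
    ∃ X Y : Set V, ConnSet G X ∧ ConnSet G Y ∧ Disjoint X Y ∧ X ∪ Y = C ∧ p ∈ X ∧ q ∈ Y ∧
      ∃ x ∈ X, ∃ y ∈ Y, G.Adj x y := by
  obtain ⟨X, -, hX⟩ := (Set.toFinite {X | ConnSet G X ∧ X ⊆ C ∧ q ∉ X ∧ p ∈ X}).exists_le_maximal
    (a := {p}) ⟨connSet_singleton p, by simpa using hp, by simpa using hpq.symm, rfl⟩
  obtain ⟨hXc, hXC, hqX, hpX⟩ := hX.prop
  -- By maximality of `X` among connected sets avoiding `q`, edges from `X` to the rest of `C` end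
  -- in `q`. Hence a part of `C \ X` without `q` can be left only inside `C \ X`.
  have hmax : ∀ x ∈ X, ∀ y ∈ C, y ∉ X → G.Adj x y → y = q := by
    intro x hx y hy hyX hxy
    by_contra hyq
    have := hX.le_of_ge (y := insert y X) ⟨hXc.insert hx hxy, Set.insert_subset hy hXC, by
      simp [hqX, Ne.symm hyq], .inr hpX⟩ (Set.subset_insert y X)
    exact hyX (this (.inl rfl))
  obtain ⟨x, hx, y, hy, hyX, hxy⟩ := hC.2 X hXC ⟨p, hpX⟩ (fun e => hqX (e ▸ hq))
  refine ⟨X, C \ X, hXc, ⟨⟨q, hq, hqX⟩, fun T hT hTne hTn => ?_⟩, disjoint_sdiff_self_right,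
    Set.union_sdiff_cancel hXC, hpX, ⟨hq, hqX⟩, x, hx, y, ⟨hy, hyX⟩, hxy⟩
  have aux : ∀ U ⊆ C \ X, U.Nonempty → q ∉ U → ∃ u ∈ U, ∃ w ∈ C \ X, w ∉ U ∧ G.Adj u w := by
    intro U hU hUne hqU
    obtain ⟨u, hu, w, hw, hwU, huw⟩ := hC.2 U (fun z hz => (hU hz).1) hUne
      (fun e => hqU (e ▸ hq))
    refine ⟨u, hu, w, ⟨hw, fun hwX => ?_⟩, hwU, huw⟩
    exact hqU (hmax w hwX u (hU hu).1 (hU hu).2 huw.symm ▸ hu)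
  by_cases hqT : q ∈ T
  · obtain ⟨s, hs, hsT⟩ := Set.exists_of_ssubset (hT.ssubset_of_ne hTn)
    obtain ⟨u, hu, w, hw, hwn, huw⟩ := aux ((C \ X) \ T) Set.sdiff_subset ⟨s, hs, hsT⟩
      (fun h => h.2 hqT)
    exact ⟨w, by_contra fun h => hwn ⟨hw, h⟩, u, hu.1, hu.2, huw.symm⟩
  · exact aux T hT hTne hqT

lemma hasMinor_complete_four {A B C D : Set V} (hA : ConnSet G A) (hB : ConnSet G B)
    (hC : ConnSet G C) (hD : ConnSet G D) (hdisj : [A, B, C, D].Pairwise Disjoint)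
    (hAB : ∃ x ∈ A, ∃ y ∈ B, G.Adj x y) (hAC : ∃ x ∈ A, ∃ y ∈ C, G.Adj x y)
    (hAD : ∃ x ∈ A, ∃ y ∈ D, G.Adj x y) (hBC : ∃ x ∈ B, ∃ y ∈ C, G.Adj x y)
    (hBD : ∃ x ∈ B, ∃ y ∈ D, G.Adj x y) (hCD : ∃ x ∈ C, ∃ y ∈ D, G.Adj x y) :
    G.HasMinor (SimpleGraph.completeGraph (Fin 4)) := by
  have hs : ∀ {X Y : Set V}, (∃ x ∈ X, ∃ y ∈ Y, G.Adj x y) → ∃ x ∈ Y, ∃ y ∈ X, G.Adj x y :=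
    fun ⟨x, hx, y, hy, h⟩ => ⟨y, hy, x, hx, h.symm⟩
  simp only [List.pairwise_cons, List.mem_cons, List.not_mem_nil, or_false, forall_eq_or_imp,
    forall_eq] at hdisj
  obtain ⟨⟨h1, h2, h3⟩, ⟨h4, h5⟩, h6, -⟩ := hdisj
  refine ⟨![A, B, C, D], fun w => connSet_iff.1 ?_, fun i j hij => ?_, fun i j hij => ?_⟩
  · fin_cases w <;> assumption
  · fin_cases i <;> fin_cases j <;>
      first | exact absurd rfl hij | assumption | (apply Disjoint.symm; assumption)
  · replace hij : i ≠ j := hij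
    fin_cases i <;> fin_cases j <;>
      first | exact absurd rfl hij | assumption | (apply hs; assumption)

lemma hasMinor_cycle_five {A B C D E : Set V} (hA : ConnSet G A) (hB : ConnSet G B)
    (hC : ConnSet G C) (hD : ConnSet G D) (hE : ConnSet G E)
    (hdisj : [A, B, C, D, E].Pairwise Disjoint)
    (hAB : ∃ x ∈ A, ∃ y ∈ B, G.Adj x y) (hBC : ∃ x ∈ B, ∃ y ∈ C, G.Adj x y)
    (hCD : ∃ x ∈ C, ∃ y ∈ D, G.Adj x y) (hDE : ∃ x ∈ D, ∃ y ∈ E, G.Adj x y)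
    (hEA : ∃ x ∈ E, ∃ y ∈ A, G.Adj x y) :
    G.HasMinor (SimpleGraph.cycleGraph 5) := by
  have hs : ∀ {X Y : Set V}, (∃ x ∈ X, ∃ y ∈ Y, G.Adj x y) → ∃ x ∈ Y, ∃ y ∈ X, G.Adj x y :=
    fun ⟨x, hx, y, hy, h⟩ => ⟨y, hy, x, hx, h.symm⟩
  simp only [List.pairwise_cons, List.mem_cons, List.not_mem_nil, or_false, forall_eq_or_imp,
    forall_eq] at hdisj
  obtain ⟨⟨h1, h2, h3, h4⟩, ⟨h5, h6, h7⟩, ⟨h8, h9⟩, h10, -⟩ := hdisj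
  refine ⟨![A, B, C, D, E], fun w => connSet_iff.1 ?_, fun i j hij => ?_, fun i j hij => ?_⟩
  · fin_cases w <;> assumption
  · fin_cases i <;> fin_cases j <;>
      first | exact absurd rfl hij | assumption | (apply Disjoint.symm; assumption)
  · replace hij : i - j = 1 ∨ j - i = 1 := SimpleGraph.cycleGraph_adj.1 hij
    fin_cases i <;> fin_cases j <;>
      first | exact absurd hij (by decide) | assumption | (apply hs; assumption)

end ConnSet

/-! ### Blocks without `K₄` and `C₅` minors -/

section Structure

variable {V : Type*} {G : SimpleGraph V}

/-- A connected set attached to the ends of a path of length two in two different vertices yields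
a `C₅` minor. -/
lemma hasMinor_cycle_five_of_ear [Finite V] {H : Set V} (hH : ConnSet G H) {u v w p q : V}
    (hu : u ∉ H) (hv : v ∉ H) (hw : w ∉ H) (huv : u ≠ v) (huw : G.Adj u w) (hwv : G.Adj w v)
    (hp : p ∈ H) (hq : q ∈ H) (hpq : p ≠ q) (hup : G.Adj u p) (hvq : G.Adj v q) :
    G.HasMinor (SimpleGraph.cycleGraph 5) := by
  obtain ⟨X, Y, hX, hY, hXY, rfl, hpX, hqY, hadj⟩ := hH.exists_split hp hq hpq
  simp only [Set.mem_union, not_or] at hu hv hw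
  refine hasMinor_cycle_five (connSet_singleton u) hX hY (connSet_singleton v)
    (connSet_singleton w) ?_ ⟨u, rfl, p, hpX, hup⟩ hadj ⟨q, hqY, v, rfl, hvq.symm⟩
    ⟨v, rfl, w, rfl, hwv.symm⟩ ⟨w, rfl, u, rfl, huw.symm⟩
  simp [hu, hv, hw, hXY, huv, huw.ne, hwv.ne']

/-- The connected component of `p` in `S \ C`. -/
lemma exists_component [Finite V] {S C : Set V} {p : V} (hp : p ∈ S) (hpC : p ∉ C) :
    ∃ H ⊆ S \ C, ConnSet G H ∧ p ∈ H ∧ ∀ x ∈ H, ∀ y ∈ S, G.Adj x y → y ∉ H → y ∈ C := by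
  obtain ⟨H, -, hH⟩ := (Set.toFinite {X | ConnSet G X ∧ X ⊆ S \ C ∧ p ∈ X}).exists_le_maximal
    (a := {p}) ⟨connSet_singleton p, by simp [hp, hpC], rfl⟩
  obtain ⟨hc, hsub, hpH⟩ := hH.prop
  refine ⟨H, hsub, hc, hpH, fun x hx y hy hxy hyH => ?_⟩
  by_contra hyC
  exact hyH (hH.le_of_ge (y := insert y H) ⟨hc.insert hx hxy, Set.insert_subset ⟨hy, hyC⟩ hsub,
    .inr hpH⟩ (Set.subset_insert y H) (.inl rfl))

/-- In a set without cut vertices, a component of the complement of `C` is attached to `C` outside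
of any given vertex. -/
lemma exists_attachment {S C H : Set V} (h2 : ∀ v ∈ S, ConnSet G (S \ {v})) (hC : C ⊆ S)
    (hHS : H ⊆ S \ C) (hne : H.Nonempty) (hcomp : ∀ x ∈ H, ∀ y ∈ S, G.Adj x y → y ∉ H → y ∈ C)
    {c c' : V} (hc : c ∈ C) (hc' : c' ∈ C) (hcc' : c' ≠ c) :
    ∃ y ∈ C, y ≠ c ∧ ∃ x ∈ H, G.Adj y x := by
  obtain ⟨x, hx, y, hy, hyH, hxy⟩ := (h2 c (hC hc)).2 H
    (fun x hx => ⟨(hHS hx).1, fun e => (hHS hx).2 (by rw [e]; exact hc)⟩) hne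
    (fun e => (hHS (e.ge ⟨hC hc', hcc'⟩)).2 hc')
  exact ⟨y, hcomp x hx y hy.1 hxy hyH, hy.2, x, hx, hxy.symm⟩

/-- In a connected set, two vertices are adjacent, or have a common neighbour, or are the ends of a
chain of four disjoint connected sets. -/
lemma ConnSet.adj_or_common_or_chain [Finite V] {H : Set V} (hH : ConnSet G H) {x y : V}
    (hx : x ∈ H) (hy : y ∈ H) (hxy : x ≠ y) :
    G.Adj x y ∨ (∃ z ∈ H, G.Adj x z ∧ G.Adj z y) ∨
      ∃ A B C D : Set V, ConnSet G A ∧ ConnSet G B ∧ ConnSet G C ∧ ConnSet G D ∧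
        [A, B, C, D].Pairwise Disjoint ∧ x ∈ A ∧ y ∈ D ∧ (∃ a ∈ A, ∃ b ∈ B, G.Adj a b) ∧
        (∃ a ∈ B, ∃ b ∈ C, G.Adj a b) ∧ (∃ a ∈ C, ∃ b ∈ D, G.Adj a b) ∧
        ∀ s ∈ [A, B, C, D], s ⊆ H := by
  have hs : ∀ {X Y : Set V}, (∃ x ∈ X, ∃ y ∈ Y, G.Adj x y) → ∃ x ∈ Y, ∃ y ∈ X, G.Adj x y :=
    fun ⟨x, hx, y, hy, h⟩ => ⟨y, hy, x, hx, h.symm⟩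
  -- three consecutive parts suffice
  have three : ∀ (A B C : Set V) (x y : V), ConnSet G A → ConnSet G B → ConnSet G C →
      Disjoint A B → Disjoint A C → Disjoint B C → x ∈ A → y ∈ C → A ⊆ H → B ⊆ H → C ⊆ H →
      ∀ b ∈ B, G.Adj x b → ∀ b' ∈ B, ∀ c ∈ C, G.Adj b' c →
      (∃ z ∈ H, G.Adj x z ∧ G.Adj z y) ∨
      ∃ A B C D : Set V, ConnSet G A ∧ ConnSet G B ∧ ConnSet G C ∧ ConnSet G D ∧
        [A, B, C, D].Pairwise Disjoint ∧ x ∈ A ∧ y ∈ D ∧ (∃ a ∈ A, ∃ b ∈ B, G.Adj a b) ∧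
        (∃ a ∈ B, ∃ b ∈ C, G.Adj a b) ∧ (∃ a ∈ C, ∃ b ∈ D, G.Adj a b) ∧
        ∀ s ∈ [A, B, C, D], s ⊆ H := by
    intro A B C x y hA hB hC hAB hAC hBC hxA hyC hAH hBH hCH b hb hxb b' hb' c hc hbc
    by_cases hcy : y = c
    · by_cases hbb : b = b'
      · subst hcy hbb
        exact .inl ⟨b, hBH hb, hxb, hbc⟩
      · right
        obtain ⟨X, Y, hX, hY, hXY, rfl, hbX, hbY, hadj⟩ := hB.exists_split hb hb' hbb
        simp only [Set.disjoint_union_left, Set.disjoint_union_right, Set.union_subset_iff]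
          at hAB hBC hBH
        exact ⟨A, X, Y, C, hA, hX, hY, hC, by simp [*], hxA, hyC, ⟨x, hxA, b, hbX, hxb⟩, hadj,
          ⟨b', hbY, c, hc, hbc⟩, by simp [*]⟩
    · right
      obtain ⟨X, Y, hX, hY, hXY, rfl, hcX, hyY, hadj⟩ := hC.exists_split hc hyC (Ne.symm hcy)
      simp only [Set.disjoint_union_right, Set.union_subset_iff] at hAC hBC hCH
      exact ⟨A, B, X, Y, hA, hB, hX, hY, by simp [*], hxA, hyY, ⟨x, hxA, b, hb, hxb⟩,
        ⟨b', hb', c, hcX, hbc⟩, hadj, by simp [*]⟩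
  -- The side of `x` splits again if `x ≠ p`, that of `y` if `y ≠ q`. Two splits give the four sets;
  -- one split gives three, to which `three` applies, from the end `y` if necessary.
  obtain ⟨X, Y, hX, hY, hXY, rfl, hxX, hyY, p, hp, q, hq, hpq⟩ := hH.exists_split hx hy hxy
  by_cases hpx : x = p
  · by_cases hqy : y = q
    · subst hpx hqy
      exact .inl hpq
    · right
      subst hpx
      obtain ⟨Q, Y', hQ, hY', hQY, rfl, hqQ, hyY', b', hb', c, hc, hbc⟩ :=
        hY.exists_split hq hyY (Ne.symm hqy)
      simp only [Set.disjoint_union_right] at hXY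
      exact three X Q Y' x y hX hQ hY' hXY.1 hXY.2 hQY hxX hyY' (by simp)
        (fun z hz => .inr (.inl hz)) (fun z hz => .inr (.inr hz)) q hqQ hpq b' hb' c hc hbc
  · right
    obtain ⟨X', P, hX', hP, hXP, rfl, hxX', hpP, b', hb', c, hc, hbc⟩ :=
      hX.exists_split hxX hp hpx
    simp only [Set.disjoint_union_left] at hXY
    by_cases hqy : y = q
    · subst hqy
      rcases three Y P X' y x hY hP hX' hXY.2.symm hXY.1.symm hXP.symm hyY hxX' (by simp)
        (fun z hz => .inl (.inr hz)) (fun z hz => .inl (.inl hz)) p hpP hpq.symm c hc b' hb'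
        hbc.symm with ⟨z, hz, h1, h2⟩ | ⟨A, B, C, D, hA, hB, hC, hD, hd, hy', hx', h1, h2, h3, h4⟩
      · exact .inl ⟨z, hz, h2.symm, h1.symm⟩
      · refine .inr ⟨D, C, B, A, hD, hC, hB, hA, ?_, hx', hy', hs h3, hs h2, hs h1, ?_⟩
        · have := List.pairwise_reverse.2 (hd.imp fun h => h.symm)
          simpa using this
        · simp only [List.mem_cons, List.not_mem_nil, or_false, forall_eq_or_imp, forall_eq]
            at h4 ⊢
          tauto
    · right
      obtain ⟨Q, Y', hQ, hY', hQY, rfl, hqQ, hyY', hadj⟩ := hY.exists_split hq hyY (Ne.symm hqy)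
      simp only [Set.disjoint_union_right] at hXY
      refine ⟨X', P, Q, Y', hX', hP, hQ, hY', by simp [*], hxX', hyY', ⟨b', hb', c, hc, hbc⟩,
        ⟨p, hpP, q, hqQ, hpq⟩, hadj, ?_⟩
      simp only [List.mem_cons, List.not_mem_nil, or_false, forall_eq_or_imp, forall_eq]
      refine ⟨?_, ?_, ?_, ?_⟩ <;> intro z hz <;> simp [hz]

variable {S : Set V}

/-- A connected set without cut vertices and without `C₅` minor that has at least three vertices
contains a triangle or a quadrangle. -/
lemma exists_triangle_or_quadrangle [Finite V] (hS : ConnSet G S)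
    (h2 : ∀ v ∈ S, ConnSet G (S \ {v})) (h5 : ¬ G.HasMinor (SimpleGraph.cycleGraph 5))
    {v w₁ w₂ : V} (hv : v ∈ S) (hw₁ : w₁ ∈ S) (hw₂ : w₂ ∈ S) (h₁ : w₁ ≠ v) (h₂ : w₂ ≠ v)
    (h₁₂ : w₁ ≠ w₂) :
    (∃ a ∈ S, ∃ b ∈ S, ∃ c ∈ S, G.Adj a b ∧ G.Adj b c ∧ G.Adj c a) ∨
      ∃ a ∈ S, ∃ x ∈ S, ∃ b ∈ S, ∃ y ∈ S, a ≠ b ∧ x ≠ y ∧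
        G.Adj a x ∧ G.Adj x b ∧ G.Adj b y ∧ G.Adj y a := by
  obtain ⟨v', hv', x, hx, -, hvx⟩ := hS.2 {v} (by simpa using hv) ⟨v, rfl⟩
    (fun e => h₁ (e.ge hw₁))
  obtain rfl : v' = v := hv'
  obtain ⟨y, hy, hyx, hvy⟩ : ∃ y ∈ S, y ≠ x ∧ G.Adj v' y := by
    obtain ⟨w, hw, y, hy, -, hvy⟩ := (h2 x hx).2 {v'} (by simpa using ⟨hv, hvx.ne⟩) ⟨v', rfl⟩
      (fun e => by
        have key : ∀ w ∈ S, w ≠ v' → w = x := fun w hw hwv => by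
          by_contra hwx; exact hwv (e.ge ⟨hw, hwx⟩)
        exact h₁₂ ((key _ hw₁ h₁).trans (key _ hw₂ h₂).symm))
    obtain rfl : w = v' := hw
    exact ⟨y, hy.1, hy.2, hvy⟩
  -- The neighbours `x` and `y` of `v'` are connected off `v'`; a chain of four sets between them
  -- closes up through `v'` to a `C₅` minor.
  rcases (h2 v' hv).adj_or_common_or_chain (x := x) (y := y) ⟨hx, hvx.ne'⟩ ⟨hy, hvy.ne'⟩ hyx.symm
    with h | ⟨z, hz, hxz, hzy⟩ | ⟨A, B, C, D, hA, hB, hC, hD, hd, hxA, hyD, e1, e2, e3, hsub⟩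
  · exact .inl ⟨v', hv, x, hx, y, hy, hvx, h, hvy.symm⟩
  · exact .inr ⟨v', hv, x, hx, z, hz.1, y, hy, fun e => hz.2 e.symm, hyx.symm, hvx, hxz, hzy,
      hvy.symm⟩
  · refine absurd (hasMinor_cycle_five (connSet_singleton v') hA hB hC hD ?_ ⟨v', rfl, x, hxA, hvx⟩
      e1 e2 e3 ⟨y, hyD, v', rfl, hvy.symm⟩) h5
    refine List.pairwise_cons.2 ⟨fun s hs => ?_, hd⟩
    exact Set.disjoint_singleton_left.2 fun h => (hsub s hs h).2 rfl

/-- A triangle in a connected set without cut vertices and `C₅` minors is the whole set, unless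
there is a quadrangle. -/
lemma eq_triangle_or_exists_quadrangle [Finite V]
    (h2 : ∀ v ∈ S, ConnSet G (S \ {v})) (h5 : ¬ G.HasMinor (SimpleGraph.cycleGraph 5))
    {a b c : V} (ha : a ∈ S) (hb : b ∈ S) (hc : c ∈ S) (hab : G.Adj a b) (hbc : G.Adj b c)
    (hca : G.Adj c a) :
    S ⊆ {a, b, c} ∨
      ∃ a ∈ S, ∃ x ∈ S, ∃ b ∈ S, ∃ y ∈ S, a ≠ b ∧ x ≠ y ∧
        G.Adj a x ∧ G.Adj x b ∧ G.Adj b y ∧ G.Adj y a := by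
  by_contra! hcon
  obtain ⟨hsub, hno⟩ := hcon
  obtain ⟨p, hp, hpC⟩ := Set.not_subset.1 hsub
  obtain ⟨H, hHS, hH, hpH, hcomp⟩ := exists_component (G := G) hp hpC
  have hC : ({a, b, c} : Set V) ⊆ S := by
    rintro _ (rfl | rfl | rfl) <;> assumption
  have haH : a ∉ H := fun h => (hHS h).2 (by simp)
  have hbH : b ∉ H := fun h => (hHS h).2 (by simp)
  have hcH : c ∉ H := fun h => (hHS h).2 (by simp)
  -- If `H` is attached to `u` and `v` by the same vertex, a quadrangle with the third vertex `w`
  -- arises, otherwise a `C₅` minor.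
  have main : ∀ u v w : V, u ∈ S → v ∈ S → w ∈ S → u ∉ H → v ∉ H → w ∉ H → u ≠ v →
      G.Adj u w → G.Adj w v → ∀ x ∈ H, G.Adj u x → ∀ y ∈ H, G.Adj v y → False := by
    intro u v w hu hv hw huH hvH hwH huv huw hwv x hx hux y hy hvy
    by_cases hxy : x = y
    · subst hxy
      exact hno u hu w hw v hv x (hHS hx).1 huv (fun e => hwH (e ▸ hx)) huw hwv hvy hux.symm
    · exact h5 (hasMinor_cycle_five_of_ear hH huH hvH hwH huv huw hwv hx hy hxy hux hvy)
  obtain ⟨y₁, hy₁, -, x₁, hx₁, e₁⟩ := exists_attachment h2 hC hHS ⟨p, hpH⟩ hcomp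
    (c := a) (c' := b) (by simp) (by simp) hab.ne'
  obtain ⟨c', hc', hcc'⟩ : ∃ c' ∈ ({a, b, c} : Set V), c' ≠ y₁ := by
    by_cases h : a = y₁
    · exact ⟨b, by simp, h ▸ hab.ne'⟩
    · exact ⟨a, by simp, h⟩
  obtain ⟨y₂, hy₂, hne, x₂, hx₂, e₂⟩ := exists_attachment h2 hC hHS ⟨p, hpH⟩ hcomp hy₁ hc' hcc'
  rcases hy₁ with rfl | rfl | rfl <;> rcases hy₂ with rfl | rfl | rfl
  · exact hne rfl
  · exact main _ _ c ha hb hc haH hbH hcH hab.ne hca.symm hbc.symm _ hx₁ e₁ _ hx₂ e₂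
  · exact main _ _ b ha hc hb haH hcH hbH hca.ne' hab hbc _ hx₁ e₁ _ hx₂ e₂
  · exact main _ _ c hb ha hc hbH haH hcH hab.ne' hbc hca _ hx₁ e₁ _ hx₂ e₂
  · exact hne rfl
  · exact main _ _ a hb hc ha hbH hcH haH hbc.ne hab.symm hca.symm _ hx₁ e₁ _ hx₂ e₂
  · exact main _ _ b hc ha hb hcH haH hbH hca.ne hbc.symm hab.symm _ hx₁ e₁ _ hx₂ e₂
  · exact main _ _ a hc hb ha hcH hbH haH hbc.ne' hca hab _ hx₁ e₁ _ hx₂ e₂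
  · exact hne rfl

/-- The vertices `a, x, b, y` of `S` form a quadrangle in this cyclic order. -/
structure IsQuadrangle (G : SimpleGraph V) (S : Set V) (a x b y : V) : Prop where
  ha : a ∈ S
  hx : x ∈ S
  hb : b ∈ S
  hy : y ∈ S
  hab : a ≠ b
  hxy : x ≠ y
  adj_ax : G.Adj a x
  adj_xb : G.Adj x b
  adj_by : G.Adj b y
  adj_ya : G.Adj y a

lemma IsQuadrangle.rotate {a x b y : V} (h : IsQuadrangle G S a x b y) :
    IsQuadrangle G S x b y a :=
  ⟨h.hx, h.hb, h.hy, h.ha, h.hxy, h.hab.symm, h.adj_xb, h.adj_by, h.adj_ya, h.adj_ax⟩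

/-- A connected set disjoint from a quadrangle is not attached to consecutive vertices of it. -/
lemma IsQuadrangle.not_consecutive {a x b y : V} (h : IsQuadrangle G S a x b y)
    (h5 : ¬ G.HasMinor (SimpleGraph.cycleGraph 5)) {H : Set V} (hH : ConnSet G H)
    (haH : a ∉ H) (hxH : x ∉ H) (hbH : b ∉ H) (hyH : y ∉ H) {p q : V} (hp : p ∈ H) (hq : q ∈ H)
    (hap : G.Adj a p) (hxq : G.Adj x q) : False := by
  refine h5 (hasMinor_cycle_five (connSet_singleton a) hH (connSet_singleton x)
    (connSet_singleton b) (connSet_singleton y) ?_ ⟨a, rfl, p, hp, hap⟩ ⟨q, hq, x, rfl, hxq.symm⟩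
    ⟨x, rfl, b, rfl, h.adj_xb⟩ ⟨b, rfl, y, rfl, h.adj_by⟩ ⟨y, rfl, a, rfl, h.adj_ya⟩)
  simp [haH, hxH, hbH, hyH, h.adj_ax.ne, h.hab, h.adj_ya.ne', h.adj_xb.ne, h.hxy, h.adj_by.ne]

/-- A component of the complement of a quadrangle attached to `a` and `b` is a single vertex whose
only neighbours are `a` and `b`. -/
lemma IsQuadrangle.component_eq [Finite V] {a x b y : V} (h : IsQuadrangle G S a x b y)
    (h2 : ∀ v ∈ S, ConnSet G (S \ {v})) (h5 : ¬ G.HasMinor (SimpleGraph.cycleGraph 5))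
    {H : Set V} (hH : ConnSet G H) (hHS : H ⊆ S \ {a, x, b, y})
    (hcomp : ∀ u ∈ H, ∀ w ∈ S, G.Adj u w → w ∉ H → w ∈ ({a, x, b, y} : Set V)) {p q r : V}
    (hp : p ∈ H) (hq : q ∈ H) (hap : G.Adj a p) (hbq : G.Adj b q) (hr : r ∈ H) :
    G.Adj r a ∧ G.Adj r b ∧ ∀ z ∈ S, G.Adj r z → z = a ∨ z = b := by
  have haH : a ∉ H := fun h => (hHS h).2 (by simp)
  have hxH : x ∉ H := fun h => (hHS h).2 (by simp)
  have hbH : b ∉ H := fun h => (hHS h).2 (by simp)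
  have hyH : y ∉ H := fun h => (hHS h).2 (by simp)
  have hsame : ∀ p ∈ H, ∀ q ∈ H, G.Adj a p → G.Adj b q → p = q := fun p hp q hq hap hbq =>
    by_contra fun hpq =>
      h5 (hasMinor_cycle_five_of_ear hH haH hbH hxH h.hab h.adj_ax h.adj_xb hp hq hpq hap hbq)
  obtain rfl := hsame p hp q hq hap hbq
  have hout : ∀ u ∈ H, ∀ w ∈ S, G.Adj u w → w ∉ H → u = p ∧ (w = a ∨ w = b) := by
    intro u hu w hw huw hwH
    rcases hcomp u hu w hw huw hwH with rfl | rfl | rfl | rfl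
    · exact ⟨hsame u hu p hp huw.symm hbq, .inl rfl⟩
    · exact (h.not_consecutive h5 hH haH hxH hbH hyH hp hu hap huw.symm).elim
    · exact ⟨(hsame p hp u hu hap huw.symm).symm, .inr rfl⟩
    · exact (h.rotate.rotate.rotate.not_consecutive h5 hH hyH haH hxH hbH hu hp huw.symm hap).elim
  -- By `hout` only `p` has neighbours outside `H`, so any other vertex of `H` would make `p` a cut
  -- vertex.
  have hHp : ∀ u ∈ H, u = p := by
    by_contra! hcon
    obtain ⟨u, hu, hup⟩ := hcon
    obtain ⟨s, hs, t, ht, htn, hst⟩ := (h2 p (hHS hp).1).2 (H \ {p})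
      (fun z hz => ⟨(hHS hz.1).1, hz.2⟩) ⟨u, hu, hup⟩
      (fun e => haH (e.ge ⟨h.ha, hap.ne⟩).1)
    exact hs.2 (hout s hs.1 t ht.1 hst fun htH => htn ⟨htH, ht.2⟩).1
  obtain rfl := hHp r hr
  exact ⟨hap.symm, hbq.symm, fun z hz hrz =>
    (hout r hr z hz hrz fun hzH => hrz.ne (hHp z hzH).symm).2⟩

/-- A vertex outside of a quadrangle is adjacent to exactly two opposite vertices of it. -/
lemma IsQuadrangle.outside [Finite V] {a x b y : V} (h : IsQuadrangle G S a x b y)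
    (h2 : ∀ v ∈ S, ConnSet G (S \ {v})) (h5 : ¬ G.HasMinor (SimpleGraph.cycleGraph 5))
    {p : V} (hp : p ∈ S) (hpC : p ∉ ({a, x, b, y} : Set V)) :
    (G.Adj p a ∧ G.Adj p b ∧ ∀ z ∈ S, G.Adj p z → z = a ∨ z = b) ∨
      (G.Adj p x ∧ G.Adj p y ∧ ∀ z ∈ S, G.Adj p z → z = x ∨ z = y) := by
  obtain ⟨H, hHS, hH, hpH, hcomp⟩ := exists_component (G := G) hp hpC
  have hC : ({a, x, b, y} : Set V) ⊆ S := by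
    rintro _ (rfl | rfl | rfl | rfl)
    exacts [h.ha, h.hx, h.hb, h.hy]
  have haH : a ∉ H := fun h => (hHS h).2 (by simp)
  have hxH : x ∉ H := fun h => (hHS h).2 (by simp)
  have hbH : b ∉ H := fun h => (hHS h).2 (by simp)
  have hyH : y ∉ H := fun h => (hHS h).2 (by simp)
  have hrot : ({x, b, y, a} : Set V) = {a, x, b, y} := by
    ext z; simp only [Set.mem_insert_iff, Set.mem_singleton_iff]; tauto
  have nc₁ := @IsQuadrangle.not_consecutive _ _ _ _ _ _ _ h h5 H hH haH hxH hbH hyH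
  have nc₂ := @IsQuadrangle.not_consecutive _ _ _ _ _ _ _ h.rotate h5 H hH hxH hbH hyH haH
  have nc₃ := @IsQuadrangle.not_consecutive _ _ _ _ _ _ _ h.rotate.rotate h5 H hH hbH hyH haH hxH
  have nc₄ := @IsQuadrangle.not_consecutive _ _ _ _ _ _ _ h.rotate.rotate.rotate h5 H hH
    hyH haH hxH hbH
  have opp₁ := @IsQuadrangle.component_eq _ _ _ _ _ _ _ _ h h2 h5 H hH hHS hcomp
  have opp₂ := @IsQuadrangle.component_eq _ _ _ _ _ _ _ _ h.rotate h2 h5 H hH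
    (by rwa [hrot]) (by rwa [hrot])
  obtain ⟨y₁, hy₁, -, x₁, hx₁, e₁⟩ := exists_attachment h2 hC hHS ⟨p, hpH⟩ hcomp
    (c := a) (c' := b) (by simp) (by simp) h.hab.symm
  obtain ⟨c', hc', hcc'⟩ : ∃ c' ∈ ({a, x, b, y} : Set V), c' ≠ y₁ := by
    by_cases h' : a = y₁
    · exact ⟨b, by simp, h' ▸ h.hab.symm⟩
    · exact ⟨a, by simp, h'⟩
  obtain ⟨y₂, hy₂, hne, x₂, hx₂, e₂⟩ := exists_attachment h2 hC hHS ⟨p, hpH⟩ hcomp hy₁ hc' hcc'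
  rcases hy₁ with rfl | rfl | rfl | rfl <;> rcases hy₂ with rfl | rfl | rfl | rfl <;>
    first
      | exact absurd rfl hne
      | exact (nc₁ hx₁ hx₂ e₁ e₂).elim
      | exact (nc₂ hx₁ hx₂ e₁ e₂).elim
      | exact (nc₃ hx₁ hx₂ e₁ e₂).elim
      | exact (nc₄ hx₁ hx₂ e₁ e₂).elim
      | exact (nc₁ hx₂ hx₁ e₂ e₁).elim
      | exact (nc₂ hx₂ hx₁ e₂ e₁).elim
      | exact (nc₃ hx₂ hx₁ e₂ e₁).elim
      | exact (nc₄ hx₂ hx₁ e₂ e₁).elim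
      | exact .inl (opp₁ hx₁ hx₂ e₁ e₂ hpH)
      | exact .inl (opp₁ hx₂ hx₁ e₂ e₁ hpH)
      | exact .inr (opp₂ hx₁ hx₂ e₁ e₂ hpH)
      | exact .inr (opp₂ hx₂ hx₁ e₂ e₁ hpH)

/-- If some vertex outside of the quadrangle is adjacent to `a` and `b`, then all are, and `x` and
`y` are not adjacent. -/
lemma IsQuadrangle.outside_all [Finite V] {a x b y : V} (h : IsQuadrangle G S a x b y)
    (h2 : ∀ v ∈ S, ConnSet G (S \ {v})) (h5 : ¬ G.HasMinor (SimpleGraph.cycleGraph 5))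
    {p : V} (hpC : p ∉ ({a, x, b, y} : Set V)) (hpa : G.Adj p a) (hpb : G.Adj p b) :
    ¬ G.Adj x y ∧ ∀ q ∈ S, q ∉ ({a, x, b, y} : Set V) →
      G.Adj q a ∧ G.Adj q b ∧ ∀ z ∈ S, G.Adj q z → z = a ∨ z = b := by
  simp only [Set.mem_insert_iff, Set.mem_singleton_iff, not_or] at hpC
  obtain ⟨hpa', hpx', hpb', hpy'⟩ := hpC
  constructor
  · intro hxy
    refine h5 (hasMinor_cycle_five (connSet_singleton p) (connSet_singleton a)
      (connSet_singleton x) (connSet_singleton y) (connSet_singleton b) ?_ ⟨p, rfl, a, rfl, hpa⟩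
      ⟨a, rfl, x, rfl, h.adj_ax⟩ ⟨x, rfl, y, rfl, hxy⟩ ⟨y, rfl, b, rfl, h.adj_by.symm⟩
      ⟨b, rfl, p, rfl, hpb.symm⟩)
    simp [hpa', hpx', hpb', hpy', h.adj_ax.ne, h.hab, h.adj_ya.ne', h.adj_xb.ne,
      h.hxy, h.adj_by.ne']
  · intro q hq hqC
    refine (h.outside h2 h5 hq hqC).resolve_right fun ⟨hqx, hqy, hqz⟩ => ?_
    simp only [Set.mem_insert_iff, Set.mem_singleton_iff, not_or] at hqC
    obtain ⟨hqa', hqx', hqb', hqy'⟩ := hqC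
    have hpq : p ≠ q := by
      rintro rfl
      rcases hqz a h.ha hpa with e | e
      · exact h.adj_ax.ne e
      · exact h.adj_ya.ne' e
    -- Here `p, a, x, q, y, b` is a hexagon, and contracting the edge `yb` makes it a pentagon.
    refine h5 (hasMinor_cycle_five (connSet_singleton p) (connSet_singleton a)
      (connSet_singleton x) (connSet_singleton q)
      ((connSet_singleton y).union (connSet_singleton b) rfl rfl h.adj_by.symm) ?_
      ⟨p, rfl, a, rfl, hpa⟩ ⟨a, rfl, x, rfl, h.adj_ax⟩ ⟨x, rfl, q, rfl, hqx.symm⟩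
      ⟨q, rfl, y, .inl rfl, hqy⟩ ⟨b, .inr rfl, p, rfl, hpb.symm⟩)
    simp [hpa', hpx', hpb', hpy', hqy', hqb', hpq, h.adj_ax.ne, h.hab, h.adj_ya.ne', h.adj_xb.ne,
      h.hxy,
      Ne.symm hqa', Ne.symm hqx']

/-- The set `S` spans a `K_{2,n}` or a `K_{1,1,n}` with centres `a` and `b`. -/
def IsDoubleStar (G : SimpleGraph V) (S : Set V) (a b : V) : Prop :=
  a ∈ S ∧ b ∈ S ∧ a ≠ b ∧ (∀ i ∈ S, ∀ j ∈ S, G.Adj i j → i = a ∨ i = b ∨ j = a ∨ j = b) ∧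
    ∀ i ∈ S, i ≠ a → i ≠ b → G.Adj a i ∧ G.Adj b i

lemma IsQuadrangle.isDoubleStar {a x b y : V} (h : IsQuadrangle G S a x b y)
    (hxy : ¬ G.Adj x y) (hall : ∀ q ∈ S, q ∉ ({a, x, b, y} : Set V) →
      G.Adj q a ∧ G.Adj q b ∧ ∀ z ∈ S, G.Adj q z → z = a ∨ z = b) : IsDoubleStar G S a b := by
  refine ⟨h.ha, h.hb, h.hab, fun i hi j hj hij => ?_, fun i hi hia hib => ?_⟩
  · by_contra hcon
    rw [not_or, not_or, not_or] at hcon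
    obtain ⟨h1, h2, h3, h4⟩ := hcon
    by_cases hiC : i ∈ ({a, x, b, y} : Set V)
    · by_cases hjC : j ∈ ({a, x, b, y} : Set V)
      · rcases hiC with rfl | rfl | rfl | rfl <;> rcases hjC with rfl | rfl | rfl | rfl <;>
          first | contradiction | exact hij.ne rfl | exact hxy hij | exact hxy hij.symm
      · rcases (hall j hj hjC).2.2 i hi hij.symm with e | e <;> contradiction
    · rcases (hall i hi hiC).2.2 j hj hij with e | e <;> contradiction
  · by_cases hiC : i ∈ ({a, x, b, y} : Set V)
    · rcases hiC with rfl | rfl | rfl | rfl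
      · exact absurd rfl hia
      · exact ⟨h.adj_ax, h.adj_xb.symm⟩
      · exact absurd rfl hib
      · exact ⟨h.adj_ya.symm, h.adj_by⟩
    · exact ⟨(hall i hi hiC).1.symm, (hall i hi hiC).2.1.symm⟩

/-- The structure of the blocks of graphs without `K₄` and `C₅` minors. -/
theorem exists_isDoubleStar [Finite V] (hS : ConnSet G S) (h2 : ∀ v ∈ S, ConnSet G (S \ {v}))
    (h4 : ¬ G.HasMinor (SimpleGraph.completeGraph (Fin 4)))
    (h5 : ¬ G.HasMinor (SimpleGraph.cycleGraph 5)) : ∃ a b, IsDoubleStar G S a b := by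
  have quad : (∃ a ∈ S, ∃ x ∈ S, ∃ b ∈ S, ∃ y ∈ S, a ≠ b ∧ x ≠ y ∧
      G.Adj a x ∧ G.Adj x b ∧ G.Adj b y ∧ G.Adj y a) → ∃ a b, IsDoubleStar G S a b := by
    rintro ⟨a, ha, x, hx, b, hb, y, hy, hab, hxy, ax, xb, hby, ya⟩
    have h : IsQuadrangle G S a x b y := ⟨ha, hx, hb, hy, hab, hxy, ax, xb, hby, ya⟩
    have hrot : ({x, b, y, a} : Set V) = {a, x, b, y} := by
      ext z; simp only [Set.mem_insert_iff, Set.mem_singleton_iff]; tauto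
    by_cases hout : ∃ p ∈ S, p ∉ ({a, x, b, y} : Set V)
    · obtain ⟨p, hp, hpC⟩ := hout
      rcases h.outside h2 h5 hp hpC with ⟨e1, e2, -⟩ | ⟨e1, e2, -⟩
      · have := h.outside_all h2 h5 hpC e1 e2
        exact ⟨a, b, h.isDoubleStar this.1 this.2⟩
      · have := h.rotate.outside_all h2 h5 (by rwa [hrot]) e1 e2
        exact ⟨x, y, h.rotate.isDoubleStar this.1 this.2⟩
    · push Not at hout
      -- `S` is the quadrangle itself. Both diagonals would give `K₄`; otherwise the centres are
      -- chosen so that the other two vertices are not adjacent.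
      by_cases hxy' : G.Adj x y
      · by_cases hab' : G.Adj a b
        · refine absurd (hasMinor_complete_four (connSet_singleton a) (connSet_singleton x)
            (connSet_singleton b) (connSet_singleton y) ?_ ⟨a, rfl, x, rfl, ax⟩
            ⟨a, rfl, b, rfl, hab'⟩ ⟨a, rfl, y, rfl, ya.symm⟩ ⟨x, rfl, b, rfl, xb⟩
            ⟨x, rfl, y, rfl, hxy'⟩ ⟨b, rfl, y, rfl, hby⟩) h4
          simp [ax.ne, hab, ya.ne', xb.ne, hxy, hby.ne]
        · exact ⟨x, y, h.rotate.isDoubleStar (fun e => hab' e.symm)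
            fun q hq hqC => absurd (hout q hq) (by rwa [← hrot])⟩
      · exact ⟨a, b, h.isDoubleStar hxy' fun q hq hqC => absurd (hout q hq) hqC⟩
  obtain ⟨v, hv⟩ := hS.1
  obtain ⟨w, hw, hwv⟩ := (h2 v hv).1
  by_cases hthree : ∃ w' ∈ S, w' ≠ v ∧ w ≠ w'
  · obtain ⟨w', hw', hw'v, hww'⟩ := hthree
    rcases exists_triangle_or_quadrangle hS h2 h5 hv hw hw' hwv hw'v hww' with
      ⟨a, ha, b, hb, c, hc, hab, hbc, hca⟩ | h
    · rcases eq_triangle_or_exists_quadrangle h2 h5 ha hb hc hab hbc hca with hsub | h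
      · have hi : ∀ i ∈ S, i ≠ a → i ≠ b → i = c := fun i hi h1 h2 => by
          rcases hsub hi with h | h | h
          exacts [absurd h h1, absurd h h2, h]
        refine ⟨a, b, ha, hb, hab.ne, fun i hi' j hj hij => ?_, fun i hi' h1 h2 => ?_⟩
        · by_contra! hcon
          exact hij.ne ((hi i hi' hcon.1 hcon.2.1).trans (hi j hj hcon.2.2.1 hcon.2.2.2).symm)
        · rw [hi i hi' h1 h2]
          exact ⟨hca.symm, hbc⟩
      · exact quad h
    · exact quad h
  · push Not at hthree
    refine ⟨v, w, hv, hw, fun e => hwv e.symm, fun i hi j _ _ => ?_, fun i hi h1 h2 => ?_⟩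
    · by_cases h : i = v
      · exact .inl h
      · exact .inr (.inl (hthree i hi h).symm)
    · exact absurd (hthree i hi h1).symm h2

end Structure

/-! ### Assembling blocks, and minors as contractions -/

section Minors

variable {V : Type*} {G : SimpleGraph V}

lemma IsDoubleStar.exchange {S : Set V} {a b : V} (h : IsDoubleStar G S a b) :
    Exchange fun i j => G.Adj i j ∧ i ∈ S ∧ j ∈ S := by
  obtain ⟨ha, hb, hab, hcover, hboth⟩ := h
  refine .doubleStar hab (fun i j h => ⟨h.1.symm, h.2.2, h.2.1⟩) (fun i h => h.1.ne rfl)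
    (fun i j h => hcover i h.2.1 j h.2.2 h.1) fun i h1 h2 => ?_
  constructor
  · exact fun h => ⟨(hboth i h.2.2 h1 h2).2, hb, h.2.2⟩
  · exact fun h => ⟨(hboth i h.2.2 h1 h2).1, ha, h.2.2⟩

/-- Connected induced subgraphs of a graph without `K₄` and `C₅` minors have the exchange
property. -/
theorem ConnSet.exchange [Finite V] (h4 : ¬ G.HasMinor (SimpleGraph.completeGraph (Fin 4)))
    (h5 : ¬ G.HasMinor (SimpleGraph.cycleGraph 5)) {S : Set V} (hS : ConnSet G S) :
    Exchange fun i j => G.Adj i j ∧ i ∈ S ∧ j ∈ S := by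
  induction hn : S.ncard using Nat.strong_induction_on generalizing S with
  | _ n ih =>
    subst hn
    by_cases h2 : ∀ v ∈ S, ConnSet G (S \ {v})
    · obtain ⟨a, b, hab⟩ := exists_isDoubleStar hS h2 h4 h5
      exact hab.exchange
    push Not at h2
    obtain ⟨v, hv, hnc⟩ := h2
    by_cases hne : (S \ {v}).Nonempty
    -- Since `v` is a cut vertex, `S \ {v}` splits into `T` and the rest with no edges between. Each
    -- together with `v` is connected and smaller than `S`, and the two meet only in `v`.
    · have : ∃ T ⊆ S \ {v}, T.Nonempty ∧ T ≠ S \ {v} ∧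
          ∀ x ∈ T, ∀ y ∈ S \ {v}, y ∉ T → ¬ G.Adj x y := by
        by_contra! hcon
        exact hnc ⟨hne, fun T hT hTne hTn => by
          obtain ⟨x, hx, y, hy, h⟩ := hcon T hT hTne hTn
          exact ⟨x, hx, y, hy, h⟩⟩
      obtain ⟨T, hT, ⟨t, ht⟩, hTn, hsep⟩ := this
      obtain ⟨s, hs, hsT⟩ := Set.exists_of_ssubset (hT.ssubset_of_ne hTn)
      have hvT : v ∉ T := fun h => (hT h).2 rfl
      have hT'sub : (S \ {v}) \ T ⊆ S \ {v} := Set.sdiff_subset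
      have hsep' : ∀ x ∈ (S \ {v}) \ T, ∀ y ∈ S \ {v}, y ∉ (S \ {v}) \ T → ¬ G.Adj x y :=
        fun x hx y hy hyn hxy =>
          hsep y (by_contra fun h => hyn ⟨hy, h⟩) x hx.1 hx.2 hxy.symm
      have c₁ := hS.insert_of_separated hv hT hsep
      have c₂ := hS.insert_of_separated hv hT'sub hsep'
      have s₁ : insert v T ⊆ S := Set.insert_subset hv fun x hx => (hT hx).1
      have s₂ : insert v ((S \ {v}) \ T) ⊆ S := Set.insert_subset hv fun x hx => hx.1.1
      have e₁ := ih _ (Set.ncard_lt_ncard (s₁.ssubset_of_ne fun e => by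
        have := e.ge hs.1
        rcases this with h | h
        exacts [hs.2 h, hsT h]) (Set.toFinite S)) c₁ rfl
      have e₂ := ih _ (Set.ncard_lt_ncard (s₂.ssubset_of_ne fun e => by
        have := e.ge (hT ht).1
        rcases this with h | h
        exacts [(hT ht).2 h, h.2 ht]) (Set.toFinite S)) c₂ rfl
      refine e₁.union (v := v) ?_ e₂ (fun i j h => h.2) (fun i j h => h.2) fun i j => ?_
      · rintro x ⟨hx | hx, hx' | hx'⟩
        exacts [hx, hx, hx', absurd hx hx'.2]
      · constructor
        · rintro ⟨hij, hi, hj⟩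
          have mem : ∀ k ∈ S, k ∉ T → k ∈ insert v ((S \ {v}) \ T) := fun k hk hkT => by
            by_cases hkv : k = v
            · exact .inl hkv
            · exact .inr ⟨⟨hk, hkv⟩, hkT⟩
          by_cases hiT : i ∈ T <;> by_cases hjT : j ∈ T
          · exact .inl ⟨hij, .inr hiT, .inr hjT⟩
          · refine .inl ⟨hij, .inr hiT, ?_⟩
            by_contra hcon
            exact hsep i hiT j ⟨hj, fun e => hcon (.inl e)⟩ hjT hij
          · refine .inl ⟨hij, ?_, .inr hjT⟩
            by_contra hcon
            exact hsep j hjT i ⟨hi, fun e => hcon (.inl e)⟩ hiT hij.symm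
          · exact .inr ⟨hij, mem i hi hiT, mem j hj hjT⟩
        · rintro (⟨hij, hi, hj⟩ | ⟨hij, hi, hj⟩)
          · exact ⟨hij, s₁ hi, s₁ hj⟩
          · exact ⟨hij, s₂ hi, s₂ hj⟩
    · refine .of_empty fun i j ⟨hij, hi, hj⟩ => ?_
      have key : ∀ k ∈ S, k = v := fun k hk => by_contra fun h => hne ⟨k, hk, h⟩
      exact hij.ne ((key i hi).trans (key j hj).symm)

/-- In a connected graph the branch sets of a minor can be enlarged to cover all vertices, so that
the minor arises from a contraction of the whole graph. -/
lemma exists_contraction [Finite V] {W : Type*} [Finite W] [Nonempty W] {H : SimpleGraph W}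
    (hG : ConnSet G Set.univ) (h : G.HasMinor H) :
    ∃ f : V → W, (∀ w, ConnSet G (f ⁻¹' {w})) ∧
      ∀ w w', H.Adj w w' → ∃ x y, f x = w ∧ f y = w' ∧ G.Adj x y := by
  classical
  obtain ⟨B₀, h₁, h₂, h₃⟩ := h
  obtain ⟨B, -, hB⟩ := (Set.toFinite {B : W → Set V | (∀ w, ConnSet G (B w)) ∧
      (∀ w w', w ≠ w' → Disjoint (B w) (B w')) ∧
      ∀ w w', H.Adj w w' → ∃ x ∈ B w, ∃ y ∈ B w', G.Adj x y}).exists_le_maximal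
    (a := B₀) ⟨fun w => connSet_iff.2 (h₁ w), h₂, h₃⟩
  obtain ⟨hc, hd, ha⟩ := hB.prop
  have hcov : ∀ v, ∃ w, v ∈ B w := by
    by_contra! hcon
    obtain ⟨v, hv⟩ := hcon
    obtain ⟨w₀⟩ := ‹Nonempty W›
    obtain ⟨x₀, hx₀⟩ := (hc w₀).1
    -- An edge leaves the union of the branch sets; adding its outer end `y` to the branch set of
    -- `x` contradicts maximality.
    obtain ⟨x, hx, y, -, hy, hxy⟩ := hG.2 (⋃ w, B w) (Set.subset_univ _)
      ⟨x₀, Set.mem_iUnion.2 ⟨w₀, hx₀⟩⟩ (fun e => by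
        obtain ⟨w, hw⟩ := Set.mem_iUnion.1 (e.ge (Set.mem_univ v))
        exact hv w hw)
    rw [Set.mem_iUnion] at hx hy
    obtain ⟨w, hx⟩ := hx
    rw [not_exists] at hy
    have hle : B ≤ Function.update B w (insert y (B w)) := by
      intro w'
      by_cases hw : w' = w
      · subst hw; simp
      · simp [hw]
    have hdis : ∀ w', w' ≠ w → Disjoint (insert y (B w)) (B w') := fun w' hw => by
      rw [Set.disjoint_insert_left]
      exact ⟨hy w', hd w w' (Ne.symm hw)⟩
    have := hB.le_of_ge (y := Function.update B w (insert y (B w))) ⟨fun w' => ?_,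
      fun w' w'' hw => ?_, fun w' w'' hw => ?_⟩ hle
    · exact hy w (this w (by simp))
    · by_cases hw : w' = w
      · subst hw
        simpa using (hc w').insert hx hxy
      · simpa [hw] using hc w'
    · by_cases h1 : w' = w
      · subst h1
        simpa [Ne.symm hw] using hdis w'' (Ne.symm hw)
      · by_cases h2 : w'' = w
        · subst h2
          simpa [h1] using (hdis w' h1).symm
        · simpa [h1, h2] using hd w' w'' hw
    · obtain ⟨u, hu, u', hu', huu⟩ := ha w' w'' hw
      exact ⟨u, hle w' hu, u', hle w'' hu', huu⟩
  choose f hf using hcov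
  have hfB : ∀ w, f ⁻¹' {w} = B w := by
    intro w
    ext v
    refine ⟨fun h => h ▸ hf v, fun h => ?_⟩
    by_contra hne
    exact Set.disjoint_left.1 (hd (f v) w hne) (hf v) h
  refine ⟨f, fun w => hfB w ▸ hc w, fun w w' hw => ?_⟩
  obtain ⟨x, hx, y, hy, hxy⟩ := ha w w' hw
  rw [← hfB] at hx hy
  exact ⟨x, y, hx, hy, hxy⟩

/-- Contraction may produce more edges than `H` has, hence the passage to a graph above `H`. This is
why the pentagon has to be excluded together with all its possible chords. -/
lemma Exchange.minor [Finite V] {W : Type*} [Finite W] [Nonempty W] {H : SimpleGraph W}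
    (hG : ConnSet G Set.univ) (h : Exchange G.Adj) (hH : G.HasMinor H) :
    ∃ H' : SimpleGraph W, H ≤ H' ∧ Exchange H'.Adj := by
  obtain ⟨f, hf, hadj⟩ := exists_contraction hG hH
  have := h.contract f (fun w => (hf w).1) fun A hA x y hxy =>
    (hf (f x)).eq_of_forall_adj (fun u hu w hw huw => hA u w huw (hu.trans (Eq.symm hw))) rfl
      hxy.symm
  exact ⟨⟨fun a b => a ≠ b ∧ ∃ x y, f x = a ∧ f y = b ∧ G.Adj x y,
    ⟨fun a b ⟨hab, x, y, hx, hy, hxy⟩ => ⟨hab.symm, y, x, hy, hx, hxy.symm⟩⟩,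
    ⟨fun a h => h.1 rfl⟩⟩, fun a b hab => ⟨hab.ne, hadj a b hab⟩, this⟩

/-- A connected graph has the exchange property if and only if it has no `K₄` and `C₅` minor. -/
theorem exchange_iff_not_hasMinor [Finite V] (hG : G.Connected) :
    Exchange G.Adj ↔ ¬ G.HasMinor (SimpleGraph.completeGraph (Fin 4)) ∧
      ¬ G.HasMinor (SimpleGraph.cycleGraph 5) := by
  have hG' : ConnSet G Set.univ :=
    connSet_iff.2 ((SimpleGraph.induceUnivIso G).connected_iff.2 hG)
  refine ⟨fun h => ⟨fun hm => ?_, fun hm => ?_⟩, fun ⟨h4, h5⟩ => ?_⟩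
  · obtain ⟨H', hle, hE⟩ := h.minor hG' hm
    exact not_exchange_of_complete (fun i j hij => hle hij) hE
  · obtain ⟨H', hle, hE⟩ := h.minor hG' hm
    refine not_exchange_of_pentagon (r := H'.Adj) (fun _ _ h => h.symm) (fun _ h => h.ne rfl)
      (fun i => hle ?_) hE
    rw [SimpleGraph.cycleGraph_adj]
    exact .inr (by simp)
  · simpa using hG'.exchange h4 h5

end Minors

/-! ### Strong Koszulness of semigroup rings in terms of exponents -/

section ToricRing

open MvPolynomial

variable {K : Type*} [Field K] {σ ι : Type*} {a : ι → σ →₀ ℕ} {f : ι → MvPolynomial σ K}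

/-- The exponent `m` is a sum of members of the family `a`. -/
def IsListSum (a : ι → σ →₀ ℕ) (m : σ →₀ ℕ) : Prop :=
  ∃ l : List ι, (l.map a).sum = m

lemma isListSum_zero : IsListSum a 0 := ⟨[], rfl⟩

lemma isListSum_self (i : ι) : IsListSum a (a i) := ⟨[i], by simp⟩

lemma IsListSum.add {m n : σ →₀ ℕ} (hm : IsListSum a m) (hn : IsListSum a n) :
    IsListSum a (m + n) := by
  obtain ⟨l, rfl⟩ := hm
  obtain ⟨l', rfl⟩ := hn
  exact ⟨l ++ l', by simp⟩

/-- The coordinate `o` plays the role of the degree: it counts the summands. -/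
lemma IsListSum.exists_eq {m : σ →₀ ℕ} (hm : IsListSum a m) {o : σ} (ho : ∀ i, a i o = 1)
    (h1 : m o = 1) : ∃ i, m = a i := by
  obtain ⟨l, rfl⟩ := hm
  have : ∀ l : List ι, (l.map a).sum o = l.length := by
    intro l
    induction l with
    | nil => simp
    | cons i l ih => simp [ih, ho, add_comm]
  rw [this, List.length_eq_one_iff] at h1
  obtain ⟨i, rfl⟩ := h1
  exact ⟨i, by simp⟩

lemma isListSum_of_mem_range (hf : ∀ i, f i = monomial (a i) 1) {p : MvPolynomial σ K}
    (hp : p ∈ (aeval f : MvPolynomial ι K →ₐ[K] MvPolynomial σ K).range) {m : σ →₀ ℕ}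
    (hm : coeff m p ≠ 0) : IsListSum a m := by
  classical
  obtain ⟨q, rfl⟩ := hp
  induction q using MvPolynomial.induction_on generalizing m with
  | C c =>
    have : m = 0 := by
      by_contra h
      exact hm (by simp [algebraMap_eq, coeff_C, Ne.symm h])
    exact this ▸ isListSum_zero
  | add p q hp hq =>
    by_cases h : coeff m (aeval f p) = 0
    · refine hq fun h' => hm ?_
      simp only [AlgHom.toRingHom_eq_coe, RingHom.coe_coe, map_add, coeff_add] at h' ⊢
      rw [h, h', add_zero]
    · exact hp h
  | mul_X p i hp =>
    simp only [AlgHom.toRingHom_eq_coe, RingHom.coe_coe, map_mul, aeval_X, hf,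
      coeff_mul_monomial', mul_one] at hm
    split_ifs at hm with hle
    · rw [← tsub_add_cancel_of_le hle]
      exact (hp hm).add (isListSum_self i)
    · exact absurd rfl hm

lemma monomial_mem_range (hf : ∀ i, f i = monomial (a i) 1) {m : σ →₀ ℕ} (hm : IsListSum a m)
    (c : K) : monomial m c ∈ (aeval f : MvPolynomial ι K →ₐ[K] MvPolynomial σ K).range := by
  obtain ⟨l, rfl⟩ := hm
  induction l with
  | nil => exact Subalgebra.algebraMap_mem _ c
  | cons i l ih =>
    have : monomial ((List.map a (i :: l)).sum) c = f i * monomial (List.map a l).sum c := by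
      rw [hf, monomial_mul, one_mul]; simp
    rw [this]
    exact Subalgebra.mul_mem _ ⟨X i, by simp⟩ ih

/-- The generator of the toric ring with index `i`. -/
noncomputable abbrev toricGen (f : ι → MvPolynomial σ K) (i : ι) :
    (aeval f : MvPolynomial ι K →ₐ[K] MvPolynomial σ K).range :=
  (aeval f : MvPolynomial ι K →ₐ[K] MvPolynomial σ K).rangeRestrict (X i)

lemma coe_toricGen (hf : ∀ i, f i = monomial (a i) 1) (i : ι) :
    (toricGen f i : MvPolynomial σ K) = monomial (a i) 1 := by
  rw [← hf, ← aeval_X (R := K) f i]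
  rfl

lemma exists_eq_add_of_mem_span (hf : ∀ i, f i = monomial (a i) 1) {i : ι}
    {p : (aeval f : MvPolynomial ι K →ₐ[K] MvPolynomial σ K).range}
    (hp : p ∈ Ideal.span {toricGen f i}) {m : σ →₀ ℕ} (hm : coeff m (p : MvPolynomial σ K) ≠ 0) :
    ∃ n, IsListSum a n ∧ m = a i + n := by
  obtain ⟨q, rfl⟩ := Ideal.mem_span_singleton'.1 hp
  rw [Subalgebra.coe_mul, coe_toricGen hf, coeff_mul_monomial'] at hm
  split_ifs at hm with hle
  · rw [mul_one] at hm
    exact ⟨m - a i, isListSum_of_mem_range hf q.2 hm, (add_tsub_cancel_of_le hle).symm⟩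
  · exact absurd rfl hm

/-- Each term of an element of the ring again lies in the ring, so membership may be tested term by
term. -/
lemma mem_ideal_of_monomials_mem (hf : ∀ i, f i = monomial (a i) 1)
    {I : Ideal (aeval f : MvPolynomial ι K →ₐ[K] MvPolynomial σ K).range}
    (p : (aeval f : MvPolynomial ι K →ₐ[K] MvPolynomial σ K).range)
    (h : ∀ m (hm : IsListSum a m), coeff m (p : MvPolynomial σ K) ≠ 0 →
      (⟨monomial m (coeff m (p : MvPolynomial σ K)), monomial_mem_range hf hm _⟩ :
        (aeval f : MvPolynomial ι K →ₐ[K] MvPolynomial σ K).range) ∈ I) : p ∈ I := by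
  have hs : ∀ m : (p : MvPolynomial σ K).support, IsListSum a m := fun m =>
    isListSum_of_mem_range hf p.2 (mem_support_iff.1 m.2)
  have : p = ∑ m ∈ (p : MvPolynomial σ K).support.attach,
      (⟨monomial (m : σ →₀ ℕ) (coeff m (p : MvPolynomial σ K)), monomial_mem_range hf (hs m) _⟩ :
        (aeval f : MvPolynomial ι K →ₐ[K] MvPolynomial σ K).range) := by
    apply Subtype.ext
    rw [AddSubmonoidClass.coe_finsetSum]
    conv_lhs => rw [(p : MvPolynomial σ K).as_sum, ← Finset.sum_attach]
  rw [this]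
  exact Ideal.sum_mem _ fun m _ => h m (hs m) (mem_support_iff.1 m.2)

lemma exists_mem_of_mem_span (hf : ∀ i, f i = monomial (a i) 1)
    {S : Set (aeval f : MvPolynomial ι K →ₐ[K] MvPolynomial σ K).range}
    {p : (aeval f : MvPolynomial ι K →ₐ[K] MvPolynomial σ K).range} (hp : p ∈ Ideal.span S)
    {m : σ →₀ ℕ} (hm : coeff m (p : MvPolynomial σ K) ≠ 0) :
    ∃ s ∈ S, ∃ q r, coeff q (s : MvPolynomial σ K) ≠ 0 ∧ IsListSum a r ∧ m = q + r := by
  classical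
  induction hp using Submodule.span_induction generalizing m with
  | mem s hs => exact ⟨s, hs, m, 0, hm, isListSum_zero, by simp⟩
  | zero => exact absurd (by simp) hm
  | add x y _ _ hx hy =>
    rw [Subalgebra.coe_add, coeff_add] at hm
    by_cases h : coeff m (x : MvPolynomial σ K) = 0
    · exact hy (by simpa [h] using hm)
    · exact hx h
  | smul c x _ hx =>
    rw [smul_eq_mul, Subalgebra.coe_mul, coeff_mul] at hm
    obtain ⟨⟨u, v⟩, huv, hne⟩ := Finset.exists_ne_zero_of_sum_ne_zero hm
    obtain ⟨s, hs, q, r, hq, hr, rfl⟩ := hx (right_ne_zero_of_mul hne)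
    refine ⟨s, hs, q, u + r, hq,
      (isListSum_of_mem_range hf c.2 (left_ne_zero_of_mul hne)).add hr, ?_⟩
    exact (Finset.HasAntidiagonal.mem_antidiagonal.1 huv).symm.trans (add_left_comm u q r)

lemma apply_eq_two_of_mem_sq (hf : ∀ i, f i = monomial (a i) 1) {o : σ} (ho : ∀ i, a i o = 1)
    {x : (aeval f : MvPolynomial ι K →ₐ[K] MvPolynomial σ K).range}
    (hx : x ∈ Submodule.span K (Set.range (toricGen f)) ^ 2) {q : σ →₀ ℕ}
    (hq : coeff q (x : MvPolynomial σ K) ≠ 0) : q o = 2 := by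
  classical
  rw [pow_two, Submodule.span_mul_span] at hx
  induction hx using Submodule.span_induction with
  | mem s hs =>
    obtain ⟨_, ⟨i, rfl⟩, _, ⟨j, rfl⟩, rfl⟩ := hs
    simp only [Subalgebra.coe_mul, coe_toricGen hf, monomial_mul, coeff_monomial, ne_eq,
      ite_eq_right_iff, Classical.not_imp] at hq
    rw [← hq.1, Finsupp.add_apply, ho, ho]
  | zero => exact absurd (by simp) hq
  | add x y _ _ hx hy =>
    rw [Subalgebra.coe_add, coeff_add] at hq
    by_cases h : coeff q (x : MvPolynomial σ K) = 0
    · exact hy (by simpa [h] using hq)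
    · exact hx h
  | smul c x _ hx =>
    rw [Subalgebra.coe_smul, coeff_smul] at hq
    exact hx (right_ne_zero_of_mul hq)

/-- Strong Koszulness of a homogeneous affine semigroup ring in terms of its exponents. -/
theorem stronglyKoszul_toricGen_iff (hf : ∀ i, f i = monomial (a i) 1) {o : σ}
    (ho : ∀ i, a i o = 1) :
    StronglyKoszul K (toricGen f) ↔
      ∀ i j, i ≠ j → ∀ m n, IsListSum a m → IsListSum a n → a i + m = a j + n →
        ∃ i' j' m', IsListSum a m' ∧ m = a i' + m' ∧ a i + a i' = a j + a j' := by
  constructor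
  · intro h i j hij m n hm hn hmn
    obtain ⟨S, hS, hI⟩ := h i j hij
    have hx : (⟨monomial (a i + m) 1, monomial_mem_range hf ((isListSum_self i).add hm) 1⟩ :
        (aeval f : MvPolynomial ι K →ₐ[K] MvPolynomial σ K).range) ∈ Ideal.span S := by
      rw [← hI]
      refine ⟨Ideal.mem_span_singleton'.2 ⟨⟨monomial m 1, monomial_mem_range hf hm 1⟩, ?_⟩,
        Ideal.mem_span_singleton'.2 ⟨⟨monomial n 1, monomial_mem_range hf hn 1⟩, ?_⟩⟩
      · apply Subtype.ext
        rw [Subalgebra.coe_mul, coe_toricGen hf, monomial_mul, add_comm, one_mul]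
      · apply Subtype.ext
        rw [Subalgebra.coe_mul, coe_toricGen hf, monomial_mul, add_comm, one_mul]
        exact congrArg (fun k => monomial k (1 : K)) hmn.symm
    -- Some monomial `q` of a generator `s` divides the given common multiple. It lies in both
    -- principal ideals, as these are spanned by monomials, and it has degree two, so both cofactors
    -- are single generators.
    obtain ⟨s, hs, q, r, hq, hr, hqr⟩ := exists_mem_of_mem_span hf hx (m := a i + m) (by
      classical simp [coeff_monomial])
    have hsI : s ∈ Ideal.span {toricGen f i} ⊓ Ideal.span {toricGen f j} :=
      hI ▸ Ideal.subset_span hs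
    obtain ⟨n₁, h₁, e₁⟩ := exists_eq_add_of_mem_span hf hsI.1 hq
    obtain ⟨n₂, h₂, e₂⟩ := exists_eq_add_of_mem_span hf hsI.2 hq
    have hqo := apply_eq_two_of_mem_sq hf ho (hS hs) hq
    obtain ⟨i', rfl⟩ := h₁.exists_eq ho (by
      have := DFunLike.congr_fun e₁ o
      rw [Finsupp.add_apply, ho] at this
      omega)
    obtain ⟨j', rfl⟩ := h₂.exists_eq ho (by
      have := DFunLike.congr_fun e₂ o
      rw [Finsupp.add_apply, ho] at this
      omega)
    refine ⟨i', j', r, hr, ?_, e₁.symm.trans e₂⟩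
    rw [e₁, add_assoc] at hqr
    exact add_left_cancel hqr
  · intro h i j hij
    -- The candidate generators are the common multiples of degree two that are products of two
    -- generators in two ways.
    obtain ⟨S, hS⟩ : ∃ S, S = {x | ∃ i' j', x = toricGen f i * toricGen f i' ∧
      toricGen f i * toricGen f i' = toricGen f j * toricGen f j'} := ⟨_, rfl⟩
    refine ⟨S, ?_, le_antisymm ?_ ?_⟩
    · rw [hS]
      rintro _ ⟨i', j', rfl, -⟩
      rw [pow_two]
      exact Submodule.mul_mem_mul (Submodule.subset_span ⟨i, rfl⟩)
        (Submodule.subset_span ⟨i', rfl⟩)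
    · intro p hp
      refine mem_ideal_of_monomials_mem hf p fun k hk hkp => ?_
      obtain ⟨m, hm, e₁⟩ := exists_eq_add_of_mem_span hf hp.1 hkp
      obtain ⟨n, hn, e₂⟩ := exists_eq_add_of_mem_span hf hp.2 hkp
      obtain ⟨i', j', m', hm', rfl, e⟩ := h i j hij m n hm hn (e₁.symm.trans e₂)
      have hij' : toricGen f i * toricGen f i' = toricGen f j * toricGen f j' := by
        apply Subtype.ext
        rw [Subalgebra.coe_mul, Subalgebra.coe_mul, coe_toricGen hf, coe_toricGen hf,
          coe_toricGen hf, coe_toricGen hf, monomial_mul, monomial_mul, e]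
      have hmem : toricGen f i * toricGen f i' ∈ S := by
        rw [hS]
        exact ⟨i', j', rfl, hij'⟩
      generalize coeff k (p : MvPolynomial σ K) = c
      have heq : (⟨monomial k c, monomial_mem_range hf hk c⟩ :
          (aeval f : MvPolynomial ι K →ₐ[K] MvPolynomial σ K).range) =
          ⟨monomial m' c, monomial_mem_range hf hm' c⟩ * (toricGen f i * toricGen f i') := by
        apply Subtype.ext
        rw [Subalgebra.coe_mul, Subalgebra.coe_mul, coe_toricGen hf, coe_toricGen hf,
          monomial_mul, monomial_mul, one_mul, mul_one, add_comm m', add_assoc]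
        exact congrArg (fun k => monomial k c) e₁
      rw [heq]
      exact Ideal.mul_mem_left _ _ (Ideal.subset_span hmem)
    · rw [hS, Ideal.span_le]
      rintro _ ⟨i', j', rfl, e⟩
      exact ⟨Ideal.mem_span_singleton.2 ⟨_, rfl⟩, Ideal.mem_span_singleton.2 ⟨_, e⟩⟩

end ToricRing

/-! ### Exponents of cuts, and switching -/

section CutExponents

variable {V : Type*}

/-- The cut determined by a two-colouring of the vertices. -/
def mkCut (A : V → Bool) : Cut V :=
  ⟨s({x | A x = true}, {x | A x = true}ᶜ), _, rfl⟩

lemma mkCut_surjective : Function.Surjective (mkCut : (V → Bool) → Cut V) := by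
  classical
  rintro ⟨_, A, rfl⟩
  refine ⟨fun x => decide (x ∈ A), Subtype.ext ?_⟩
  simp [mkCut]

lemma mkCut_separates_iff (A : V → Bool) (i j : V) :
    (mkCut A).Separates s(i, j) ↔ A i ≠ A j := by
  constructor
  · rintro ⟨B, hB, i', j', hij, hi, hj⟩
    have hne : A i' ≠ A j' := by
      rcases Sym2.mem_iff.1 hB with rfl | rfl
      · intro e
        exact hj (e.symm.trans hi)
      · intro e
        exact hj fun h => hi (e.trans h)
    rcases Sym2.eq_iff.1 hij with ⟨rfl, rfl⟩ | ⟨rfl, rfl⟩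
    exacts [hne, hne.symm]
  · intro hne
    by_cases hi : A i = true
    · exact ⟨_, Sym2.mem_mk_left _ _, i, j, rfl, hi, fun h => hne (hi.trans (Eq.symm h))⟩
    · refine ⟨_, Sym2.mem_mk_left _ _, j, i, Sym2.eq_swap, ?_, hi⟩
      rw [Bool.not_eq_true] at hi
      simpa [hi] using hne

/-- The two colourings are equal or complementary, and cuts are unordered. -/
lemma mkCut_eq_of_forall_xor {A B : V → Bool} (h : ∀ i j, (A i ^^ B i) = (A j ^^ B j)) :
    mkCut A = mkCut B := by
  by_cases hAB : A = B
  · rw [hAB]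
  · obtain ⟨x, hx⟩ := Function.ne_iff.1 hAB
    have : {x | A x = true} = {x | B x = true}ᶜ := by
      ext y
      have := h x y
      revert this hx
      simp only [Set.mem_ofPred_eq, Set.mem_compl_iff]
      cases A x <;> cases B x <;> cases A y <;> cases B y <;> simp
    apply Subtype.ext
    simp only [mkCut, this, compl_compl]
    exact Sym2.eq_swap

/-- Switching a cut along `C`. -/
def switch (C A : V → Bool) : V → Bool := fun i => A i ^^ C i

lemma sepCount_map_switch (C : V → Bool) (L : List (V → Bool)) (i j : V) :
    sepCount (L.map (switch C)) i j =
      if C i = C j then sepCount L i j else L.length - sepCount L i j := by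
  induction L with
  | nil => simp
  | cons A L ih =>
    have := sepCount_le_length L i j
    simp only [List.map_cons, sepCount_cons, ih, switch, List.length_cons]
    obtain h_Ai | h_Ai := Bool.eq_false_or_eq_true (A i) <;>
    obtain h_Aj | h_Aj := Bool.eq_false_or_eq_true (A j) <;>
    obtain h_Ci | h_Ci := Bool.eq_false_or_eq_true (C i) <;>
    obtain h_Cj | h_Cj := Bool.eq_false_or_eq_true (C j) <;>
    simp [h_Ai, h_Aj, h_Ci, h_Cj] <;> omega

variable [Fintype V] (G : SimpleGraph V)

open Classical in
/-- The exponent vector of the monomial of a cut. -/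
noncomputable def cutExp (c : Cut V) : Option G.edgeSet →₀ ℕ :=
  Finsupp.single none 1 +
    ∑ e ∈ Finset.univ.filter (fun e : G.edgeSet => c.Separates (e : Sym2 V)),
      Finsupp.single (some e) 1

lemma cutMonomial_eq_monomial (K : Type*) [Field K] (c : Cut V) :
    cutMonomial K G c = MvPolynomial.monomial (cutExp G c) 1 := by
  classical
  have h : ∀ s t : Option G.edgeSet →₀ ℕ, MvPolynomial.monomial (s + t) (1 : K) =
      MvPolynomial.monomial s 1 * MvPolynomial.monomial t 1 := fun s t => by
    rw [MvPolynomial.monomial_mul, one_mul]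
  rw [cutMonomial, cutExp, h, MvPolynomial.monomial_sum_one]
  rfl

lemma cutExp_none (c : Cut V) : cutExp G c none = 1 := by
  simp [cutExp]

open Classical in
lemma cutExp_some (c : Cut V) (e : G.edgeSet) :
    cutExp G c (some e) = if c.Separates (e : Sym2 V) then 1 else 0 := by
  simp [cutExp, Finsupp.single_apply]

/-- The exponent vector of the product of the monomials of a family of cuts. -/
noncomputable def listExp (L : List (V → Bool)) : Option G.edgeSet →₀ ℕ :=
  (L.map fun A => cutExp G (mkCut A)).sum

lemma listExp_cons (A : V → Bool) (L : List (V → Bool)) :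
    listExp G (A :: L) = cutExp G (mkCut A) + listExp G L := by
  simp [listExp]

lemma isListSum_cutExp_iff {m : Option G.edgeSet →₀ ℕ} :
    IsListSum (cutExp G) m ↔ ∃ L, m = listExp G L := by
  constructor
  · rintro ⟨l, rfl⟩
    obtain ⟨L, rfl⟩ := List.map_surjective_iff.2 mkCut_surjective l
    exact ⟨L, by simp [listExp, Function.comp_def]⟩
  · rintro ⟨L, rfl⟩
    exact ⟨L.map mkCut, by simp [listExp, Function.comp_def]⟩

lemma listExp_none (L : List (V → Bool)) : listExp G L none = L.length := by
  induction L with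
  | nil => simp [listExp]
  | cons A L ih => simp [listExp_cons, ih, cutExp_none, add_comm]

lemma listExp_some (L : List (V → Bool)) {i j : V} (h : G.Adj i j) :
    listExp G L (some ⟨s(i, j), h⟩) = sepCount L i j := by
  induction L with
  | nil => simp [listExp]
  | cons A L ih =>
    rw [listExp_cons, Finsupp.add_apply, ih, cutExp_some, sepCount_cons, add_comm]
    simp [mkCut_separates_iff, ite_not]

lemma listExp_eq_iff {L L' : List (V → Bool)} :
    listExp G L = listExp G L' ↔
      L.length = L'.length ∧ ∀ i j, G.Adj i j → sepCount L i j = sepCount L' i j := by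
  constructor
  · intro h
    exact ⟨by rw [← listExp_none G, h, listExp_none], fun i j hij => by
      rw [← listExp_some G L hij, h, listExp_some]⟩
  · rintro ⟨h1, h2⟩
    ext (_ | ⟨e, he⟩)
    · rw [listExp_none, listExp_none, h1]
    · induction e using Sym2.ind with
      | _ i j => rw [listExp_some G L he, listExp_some G L' he, h2 i j he]

/-- Strong Koszulness of the cut ring of a connected graph is the exchange property. -/
theorem stronglyKoszul_iff_exchange (K : Type*) [Field K] (hG : G.Connected) :
    StronglyKoszul K (gen K G) ↔ Exchange G.Adj := by
  have key := stronglyKoszul_toricGen_iff (K := K) (cutMonomial_eq_monomial G K)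
    (cutExp_none G)
  refine Iff.trans key ?_
  have hone : ∀ A, cutExp G (mkCut A) = listExp G [A] := fun A => by simp [listExp]
  constructor
  · refine fun h => .of_nontrivial fun D L N hL hlen hcount ⟨x, y, hxy, hD⟩ => ?_
    -- The empty cut serves as the first of the two cuts: it contributes to the length but separates
    -- nothing.
    have hne : mkCut (fun _ : V => false) ≠ mkCut D := fun e => by
      have h1 := mkCut_separates_iff D x y
      rw [← e, mkCut_separates_iff] at h1
      exact h1.2 hD rfl
    obtain ⟨c, d, m, hm, e₁, e₂⟩ := h _ _ hne (listExp G L) (listExp G N)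
      ((isListSum_cutExp_iff G).2 ⟨L, rfl⟩) ((isListSum_cutExp_iff G).2 ⟨N, rfl⟩) (by
        rw [← listExp_cons, ← listExp_cons, listExp_eq_iff]
        refine ⟨by simp [hlen], fun i j hij => ?_⟩
        rw [sepCount_cons, hcount i j hij]
        simp)
    obtain ⟨A, rfl⟩ := mkCut_surjective c
    obtain ⟨B, rfl⟩ := mkCut_surjective d
    obtain ⟨L', rfl⟩ := (isListSum_cutExp_iff G).1 hm
    rw [← listExp_cons, listExp_eq_iff] at e₁
    rw [hone A, hone B, ← listExp_cons, ← listExp_cons, listExp_eq_iff] at e₂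
    refine ⟨A, L', e₁.1.symm, e₁.2, fun i j hij hD hA => ?_⟩
    have := e₂.2 i j hij
    simp only [sepCount_cons, sepCount_nil, hD, hA, if_true, if_false] at this
    omega
  · intro h c d hcd m n hm hn hmn
    obtain ⟨C, rfl⟩ := mkCut_surjective c
    obtain ⟨D, rfl⟩ := mkCut_surjective d
    obtain ⟨L, rfl⟩ := (isListSum_cutExp_iff G).1 hm
    obtain ⟨N, rfl⟩ := (isListSum_cutExp_iff G).1 hn
    rw [← listExp_cons, ← listExp_cons, listExp_eq_iff] at hmn
    obtain ⟨hlen, hcount⟩ := hmn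
    have hlen' : L.length = N.length := by simpa using hlen
    -- Otherwise `C` and `D` separate the same edges and are the same cut, because `G` is connected.
    have hL : L ≠ [] := by
      rintro rfl
      obtain rfl : N = [] := List.length_eq_zero_iff.1 hlen'.symm
      refine hcd (mkCut_eq_of_forall_xor fun i j => ?_)
      have hG' : ConnSet G Set.univ :=
        connSet_iff.2 ((SimpleGraph.induceUnivIso G).connected_iff.2 hG)
      refine hG'.eq_of_forall_adj (A := fun i => C i ^^ D i) (fun x _ y _ hxy => ?_)
        (Set.mem_univ i) (Set.mem_univ j)
      have := hcount x y hxy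
      simp only [sepCount_cons, sepCount_nil] at this
      revert this
      cases C x <;> cases C y <;> cases D x <;> cases D y <;> simp
    -- Switching along `C` turns `C` into the empty cut and keeps the equality of counts, since both
    -- sides have the same length.
    obtain ⟨A, L', h1, h2, h3⟩ := h (switch C D) (L.map (switch C)) (N.map (switch C))
      (by simpa using hL) (by simpa using hlen') (fun i j hij => by
        have e := hcount i j hij
        have l₁ := sepCount_le_length L i j
        have l₂ := sepCount_le_length N i j
        rw [sepCount_cons] at e ⊢
        rw [sepCount_cons] at e
        rw [sepCount_map_switch, sepCount_map_switch]
        simp only [switch]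
        revert e
        obtain h_Ci | h_Ci := Bool.eq_false_or_eq_true (C i) <;>
        obtain h_Cj | h_Cj := Bool.eq_false_or_eq_true (C j) <;>
        obtain h_Di | h_Di := Bool.eq_false_or_eq_true (D i) <;>
        obtain h_Dj | h_Dj := Bool.eq_false_or_eq_true (D j) <;>
        simp [h_Ci, h_Cj, h_Di, h_Dj] <;> omega)
    -- Switching back yields the first factor. The degree-two relation holds at each edge: if `C`
    -- and `D` agree on it the two sides are equal termwise, and otherwise `A` separates it and both
    -- sides count one.
    refine ⟨mkCut (switch C A), mkCut (switch D A), listExp G (L'.map (switch C)),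
      (isListSum_cutExp_iff G).2 ⟨_, rfl⟩, ?_, ?_⟩
    · rw [← listExp_cons, listExp_eq_iff]
      refine ⟨by simpa using h1.symm, fun i j hij => ?_⟩
      have e := h2 i j hij
      have : switch C A :: L'.map (switch C) = (A :: L').map (switch C) := rfl
      rw [this, sepCount_map_switch, ← e, sepCount_map_switch]
      have l₁ := sepCount_le_length L i j
      simp only [List.length_cons, h1, List.length_map]
      split_ifs
      · rfl
      · omega
    · rw [hone (switch C A), hone (switch D A), ← listExp_cons, ← listExp_cons, listExp_eq_iff]
      refine ⟨rfl, fun i j hij => ?_⟩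
      have := h3 i j hij
      revert this
      simp only [sepCount_cons, sepCount_nil, switch]
      obtain h_Ai | h_Ai := Bool.eq_false_or_eq_true (A i) <;>
      obtain h_Aj | h_Aj := Bool.eq_false_or_eq_true (A j) <;>
      obtain h_Ci | h_Ci := Bool.eq_false_or_eq_true (C i) <;>
      obtain h_Cj | h_Cj := Bool.eq_false_or_eq_true (C j) <;>
      obtain h_Di | h_Di := Bool.eq_false_or_eq_true (D i) <;>
      obtain h_Dj | h_Dj := Bool.eq_false_or_eq_true (D j) <;>
      simp [h_Ai, h_Aj, h_Ci, h_Cj, h_Di, h_Dj]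

end CutExponents
end CutIdeal

theorem mainTheorem1 (K : Type*) [Field K] {V : Type*} [Fintype V] (G : SimpleGraph V)
    (hG : G.Connected) :
    CutIdeal.StronglyKoszul K (CutIdeal.gen K G) ↔
      ¬ G.HasMinor (SimpleGraph.completeGraph (Fin 4)) ∧
        ¬ G.HasMinor (SimpleGraph.cycleGraph 5) :=
  (CutIdeal.stronglyKoszul_iff_exchange G K hG).trans (CutIdeal.exchange_iff_not_hasMinor hG)
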